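/- For $0<\lambda<\mu$ consider the M/M/1 queue with arrival rate $\lambda$ and service rate $\mu$. Its queue length has equilibrium law $\pi_{\lambda,\mu}(x)=(1-\frac{\lambda}{\mu})(\frac{\lambda}{\mu})^x$, $x\in\mathbb{Z}_{\ge 0}$, and its workload (the time from $t$ on until the queue is empty, not counting later arrivals) has equilibrium law $(1-\frac{\lambda}{\mu})\delta_0+\frac{\lambda}{\mu}\,\mathrm{Exp}(\mu-\lambda)$; both laws are invariant. Let $\|P-Q\|_{TV}=\sup_A|P(A)-Q(A)|$. (a) Let $0<\lambda_0<\mu$ and $0<\lambda<\mu$. Let $d(t)$ be the total variation distance between the law at time $t$ of the queue length, started from the equilibrium for $(\lambda_0,\mu)$ and run with rates $(\lambda,\mu)$, and the equilibrium for $(\lambda,\mu)$. Put $\alpha^\star=(\sqrt\mu-\sqrt\lambda)^2$ and, for $\alpha\le\alpha^\star$, $$g(\alpha)=\frac{1}{2\lambda}\Big(\lambda+\mu-\alpha-\sqrt{(\lambda+\mu-\alpha)^2-4\lambda\mu}\Big),\qquad G(\alpha)=\frac{1-\frac{\lambda_0}{\mu}}{1-\frac{\lambda_0}{\mu}\,g(\alpha)}.$$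 Case 1. If $\lambda\ge\lambda_0$, then $d(t)\le\big(1+\sqrt{\lambda/\mu}\big)e^{-\alpha^\star t}$ for all $t\ge 0$. Case 2. Let $\lambda_0>\lambda$. - If $\lambda_0>\sqrt{\lambda\mu}$, then $0<\lambda+\mu-\lambda_0-\frac{\lambda\mu}{\lambda_0}\le\alpha^\star$, and for every $\alpha$ with $0<\alpha<\lambda+\mu-\lambda_0-\frac{\lambda\mu}{\lambda_0}$ we have $\frac{\lambda_0}{\mu}g(\alpha)<1$ and $d(t)\le G(\alpha)e^{-\alpha t}$ for all $t\ge 0$. - If $\lambda_0<\sqrt{\lambda\mu}$, then $\frac{\lambda_0}{\mu}g(\alpha^\star)<1$ and $d(t)\le G(\alpha^\star)e^{-\alpha^\star t}$ for all $t\ge 0$. - If $\lambda_0=\sqrt{\lambda\mu}$, then there is a constant $C$, depending only on the rates, with $d(t)\le C e^{-\alpha^\star t}$ for all $t\ge 0$. (b) The same bounds hold when $d(t)$ is the corresponding distance for the workload process (started from the workload equilibrium for $(\lambda_0,\mu)$, run with rates $(\lambda,\mu)$, and compared with the workload equilibrium for $(\lambda,\mu)$). (c) Let $0<\lambda_0<\mu_0$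 and $0<\lambda<\mu$, and write $\lambda=ab\lambda_0$, $\mu=b\mu_0$. Let $D(t)$ be the total variation distance between the law at time $t$ of the queue length, started from $\pi_{\lambda_0,\mu_0}$ and run with rates $(\lambda,\mu)$, and $\pi_{\lambda,\mu}$. Then $D(t)=d(bt)$ for all $t\ge 0$, where $d$ is the distance in (a) for the change of arrival rate from $\lambda_0$ to $a\lambda_0$ at service rate $\mu_0$; hence $D(t)$ obeys the bounds of (a) with $(\lambda,\mu)$ replaced by $(a\lambda_0,\mu_0)$ and $t$ replaced by $bt$. -/

import Mathlib

open MeasureTheory ProbabilityTheory Real Set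
open scoped ENNReal NNReal Nat

noncomputable section

namespace MM1

/-- Total variation distance `sup_A |P(A) - Q(A)|`, over measurable sets `A`. -/
def tvDist {Ω : Type*} [MeasurableSpace Ω] (P Q : Measure Ω) : ℝ :=
  ⨆ A : {A : Set Ω // MeasurableSet A}, |P.real A - Q.real A|

/-! ### The queue-length process -/

/-- Equilibrium queue length of the M/M/1 queue with arrival rate `l` and service rate `m`:
`π(x) = (1 - l/m) (l/m)^x`. -/
def queueEq (l m : ℝ) : Measure ℕ :=
  Measure.sum fun x : ℕ => ENNReal.ofReal ((1 - l / m) * (l / m) ^ x) • Measure.dirac x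

/-- Arrivals occur at the epochs of a Poisson process of rate `l`, potential service completions at
those of an independent Poisson process of rate `m`. In the superposition, which has rate `l + m`,
every epoch is independently an arrival with probability `l/(l+m)`, and otherwise a service
completion, which has no effect on an empty queue (`0 - 1 = 0` in `ℕ`). This is the law of the
queue length just after such an epoch if it was `x` just before. -/
def queueStep (l m : ℝ) (x : ℕ) : Measure ℕ :=
  ENNReal.ofReal (l / (l + m)) • Measure.dirac (x + 1) +
    ENNReal.ofReal (m / (l + m)) • Measure.dirac (x - 1)

/-- Law of the queue length after `n` epochs, with initial law `ν`. -/
def queueStepLaw (l m : ℝ) (ν : Measure ℕ) : ℕ → Measure ℕ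
  | 0 => ν
  | n + 1 => (queueStepLaw l m ν n).bind (queueStep l m)

/-- Law at time `t ≥ 0` of the queue length `X_t` of the M/M/1 queue with arrival rate `l`, service
rate `m` and initial law `ν`: the number of epochs up to time `t` is Poisson with mean `(l + m) t`.
Equivalently this is `ν e^{tQ}` for the generator `Q` of the queue; see
`queueLaw_zero` and `queueLaw_forward` below. -/
def queueLaw (l m : ℝ) (ν : Measure ℕ) (t : ℝ) : Measure ℕ :=
  (poissonMeasure ((l + m) * t).toNNReal).bind (queueStepLaw l m ν)

/-! The next facts certify that `queueLaw` is the law of the birth-death process with the rates of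
the M/M/1 queue: it starts from `ν` and solves the forward equation of the generator. -/

lemma isProbabilityMeasure_queueStep {l m : ℝ} (hl : 0 < l) (hm : 0 < m) (x : ℕ) :
    IsProbabilityMeasure (queueStep l m x) := by
  constructor
  have h : 0 < l + m := by positivity
  simp only [queueStep, Measure.add_apply, Measure.smul_apply, measure_univ, smul_eq_mul, mul_one]
  rw [← ENNReal.ofReal_add (by positivity) (by positivity), ← add_div, div_self h.ne',
    ENNReal.ofReal_one]

lemma isProbabilityMeasure_queueStepLaw {l m : ℝ} (hl : 0 < l) (hm : 0 < m) (ν : Measure ℕ)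
    [IsProbabilityMeasure ν] (n : ℕ) : IsProbabilityMeasure (queueStepLaw l m ν n) := by
  induction n with
  | zero => simpa [queueStepLaw]
  | succ n ih =>
    constructor
    rw [queueStepLaw, Measure.bind_apply MeasurableSet.univ (by fun_prop)]
    have := isProbabilityMeasure_queueStep hl hm
    simp

lemma queueLaw_zero (l m : ℝ) (ν : Measure ℕ) : queueLaw l m ν 0 = ν := by
  ext s hs
  rw [queueLaw, Measure.bind_apply hs (by fun_prop), poissonMeasure, lintegral_sum_measure,
    tsum_eq_single 0]
  · simp [queueStepLaw]
  · intro n hn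
    simp [hn]

lemma queueStepLaw_succ_real {l m : ℝ} (hl : 0 < l) (hm : 0 < m) (ν : Measure ℕ)
    [IsProbabilityMeasure ν] (n y : ℕ) :
    (l + m) * (queueStepLaw l m ν (n + 1)).real {y} =
      (if y = 0 then m * (queueStepLaw l m ν n).real {0}
        else l * (queueStepLaw l m ν n).real {y - 1}) +
      m * (queueStepLaw l m ν n).real {y + 1} := by
  have := isProbabilityMeasure_queueStepLaw hl hm ν n
  have h : 0 < l + m := by positivity
  have key : (queueStepLaw l m ν (n + 1)) {y} =
      ENNReal.ofReal (l / (l + m)) * (queueStepLaw l m ν n) ((fun x => x + 1) ⁻¹' {y}) +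
      ENNReal.ofReal (m / (l + m)) * (queueStepLaw l m ν n) ((fun x => x - 1) ⁻¹' {y}) := by
    rw [queueStepLaw, Measure.bind_apply (by measurability) (by fun_prop)]
    simp only [queueStep, Measure.add_apply, Measure.smul_apply, smul_eq_mul]
    rw [lintegral_add_left (by fun_prop), lintegral_const_mul _ (by fun_prop),
      lintegral_const_mul _ (by fun_prop)]
    have e : ∀ f : ℕ → ℕ, ∫⁻ x, Measure.dirac (f x) {y} ∂(queueStepLaw l m ν n) =
        (queueStepLaw l m ν n) (f ⁻¹' {y}) := by
      intro f
      rw [← lintegral_indicator_one (by measurability)]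
      refine lintegral_congr fun x => ?_
      rw [Measure.dirac_apply' _ (by measurability)]
      rfl
    rw [e, e]
  have key' : (queueStepLaw l m ν (n + 1)).real {y} =
      l / (l + m) * (queueStepLaw l m ν n).real ((fun x => x + 1) ⁻¹' {y}) +
      m / (l + m) * (queueStepLaw l m ν n).real ((fun x => x - 1) ⁻¹' {y}) := by
    rw [measureReal_def, key, ENNReal.toReal_add (by finiteness) (by finiteness),
      ENNReal.toReal_mul, ENNReal.toReal_mul, ENNReal.toReal_ofReal (by positivity),
      ENNReal.toReal_ofReal (by positivity)]
    rfl
  rw [key']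
  rcases y with _ | y
  · have h1 : ((fun x : ℕ => x + 1) ⁻¹' {0}) = ∅ := by ext x; simp
    have h2 : ((fun x : ℕ => x - 1) ⁻¹' {0}) = {0} ∪ {1} := by ext x; simp; omega
    rw [h1, h2, measureReal_union (by simp) (by measurability)]
    simp
    field_simp
  · have h1 : ((fun x : ℕ => x + 1) ⁻¹' {y + 1}) = {y} := by ext x; simp
    have h2 : ((fun x : ℕ => x - 1) ⁻¹' {y + 1}) = {y + 2} := by ext x; simp
    rw [h1, h2]
    simp
    field_simp

lemma summable_poisson_mul {a : ℕ → ℝ} (ha : ∀ n, |a n| ≤ 1) (r : ℝ) :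
    Summable fun n => r ^ n / n ! * a n := by
  refine Summable.of_norm_bounded (Real.summable_pow_div_factorial |r|) fun n => ?_
  rw [norm_mul, norm_div, norm_pow, Real.norm_eq_abs, Real.norm_eq_abs, Real.norm_eq_abs,
    Nat.abs_cast]
  exact mul_le_of_le_one_right (by positivity) (ha n)

lemma hasDerivAt_poisson_mul {a : ℕ → ℝ} (ha : ∀ n, |a n| ≤ 1) (r : ℝ) :
    HasDerivAt (fun r => ∑' n, r ^ n / n ! * a n) (∑' n, r ^ n / n ! * a (n + 1)) r := by
  set R := |r| + 1 with hR
  have h := hasDerivAt_tsum_of_isPreconnected (𝕜 := ℝ) (F := ℝ)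
    (u := fun n : ℕ => n * R ^ (n - 1) / n !) (t := Metric.ball 0 R)
    (g := fun n r => r ^ n / n ! * a n) (g' := fun n r => n * r ^ (n - 1) / n ! * a n)
    (y₀ := 0) (y := r) ?_ Metric.isOpen_ball (convex_ball _ _).isPreconnected ?_ ?_ ?_
    (summable_poisson_mul ha 0) ?_
  · have hs : Summable fun n : ℕ => n * r ^ (n - 1) / n ! * a n := by
      rw [← summable_nat_add_iff 1]
      refine (summable_poisson_mul (a := fun n => a (n + 1)) (fun n => ha _) r).congr fun n => ?_
      rw [Nat.factorial_succ]
      push_cast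
      field_simp
    refine h.congr_deriv ?_
    rw [hs.tsum_eq_zero_add]
    simp only [Nat.cast_zero, zero_mul, zero_div, zero_add]
    refine tsum_congr fun n => ?_
    rw [Nat.factorial_succ]
    push_cast
    field_simp
  · rw [← summable_nat_add_iff 1]
    refine (Real.summable_pow_div_factorial R).congr fun n => ?_
    rw [Nat.factorial_succ]
    push_cast
    field_simp
  · intro n y _
    exact ((hasDerivAt_pow n y).div_const _).mul_const _
  · intro n y hy
    have hy' : |y| ≤ R := by simpa using (mem_ball_zero_iff.1 hy).le
    rw [norm_mul, norm_div, norm_mul, norm_pow, Real.norm_eq_abs, Real.norm_eq_abs,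
      Real.norm_eq_abs, Real.norm_eq_abs, Nat.abs_cast, Nat.abs_cast]
    refine (mul_le_of_le_one_right (by positivity) (ha n)).trans ?_
    gcongr
  · simp [hR]; positivity
  · simp [hR]

lemma queueLaw_real {l m : ℝ} (hl : 0 < l) (hm : 0 < m) (ν : Measure ℕ) [IsProbabilityMeasure ν]
    {t : ℝ} (ht : 0 ≤ t) (y : ℕ) :
    (queueLaw l m ν t).real {y} = exp (-((l + m) * t)) *
      ∑' n : ℕ, ((l + m) * t) ^ n / n ! * (queueStepLaw l m ν n).real {y} := by
  have hr : 0 ≤ (l + m) * t := by positivity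
  have hp := isProbabilityMeasure_queueStepLaw hl hm ν
  rw [measureReal_def, queueLaw, Measure.bind_apply (by measurability) (by fun_prop),
    poissonMeasure, lintegral_sum_measure, ENNReal.tsum_toReal_eq, ← tsum_mul_left]
  · refine tsum_congr fun n => ?_
    rw [lintegral_smul_measure, lintegral_dirac, smul_eq_mul, ENNReal.toReal_mul,
      ENNReal.toReal_ofReal (by positivity), Real.coe_toNNReal _ hr, measureReal_def]
    ring
  · intro n
    rw [lintegral_smul_measure, lintegral_dirac, smul_eq_mul]
    finiteness

/-- The forward equation `d/dt ν_t = ν_t Q` of the M/M/1 queue: `x → x + 1` at rate `l`, and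
`x → x - 1` at rate `m` for `x ≥ 1`. -/
lemma queueLaw_forward {l m : ℝ} (hl : 0 < l) (hm : 0 < m) (ν : Measure ℕ)
    [IsProbabilityMeasure ν] {t : ℝ} (ht : 0 ≤ t) (y : ℕ) :
    HasDerivWithinAt (fun s => (queueLaw l m ν s).real {y})
      ((if y = 0 then 0 else l * (queueLaw l m ν t).real {y - 1}) +
        m * (queueLaw l m ν t).real {y + 1} -
        (l + if y = 0 then 0 else m) * (queueLaw l m ν t).real {y}) (Ici 0) t := by
  have hp := isProbabilityMeasure_queueStepLaw hl hm ν
  have hb : ∀ y n, |(queueStepLaw l m ν n).real {y}| ≤ 1 := fun y n => by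
    rw [abs_of_nonneg measureReal_nonneg]; exact measureReal_le_one
  have hlin : HasDerivAt (fun s : ℝ => (l + m) * s) (l + m) t := by
    simpa using (hasDerivAt_id t).const_mul (l + m)
  have hn : HasDerivAt (fun s : ℝ => -((l + m) * s)) (-(l + m)) t := hlin.neg
  have h1 := hn.exp.mul
    ((hasDerivAt_poisson_mul (hb y) ((l + m) * t)).comp t hlin)
  have h2 := h1.hasDerivWithinAt (s := Ici 0)
  have h3 := h2.congr (f₁ := fun s => (queueLaw l m ν s).real {y})
    (fun s hs => queueLaw_real hl hm ν hs y) (queueLaw_real hl hm ν ht y)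
  refine h3.congr_deriv ?_
  have hS := fun y => summable_poisson_mul (hb y) ((l + m) * t)
  have e : (l + m) * ∑' n : ℕ, ((l + m) * t) ^ n / n ! * (queueStepLaw l m ν (n + 1)).real {y} =
      (if y = 0 then
        m * ∑' n : ℕ, ((l + m) * t) ^ n / n ! * (queueStepLaw l m ν n).real {0}
      else l * ∑' n : ℕ, ((l + m) * t) ^ n / n ! * (queueStepLaw l m ν n).real {y - 1}) +
      m * ∑' n : ℕ, ((l + m) * t) ^ n / n ! * (queueStepLaw l m ν n).real {y + 1} := by
    rw [← tsum_mul_left]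
    split_ifs with h0
    · rw [← tsum_mul_left, ← tsum_mul_left,
        ← ((hS 0).mul_left m).tsum_add ((hS (y + 1)).mul_left m)]
      refine tsum_congr fun n => ?_
      rw [mul_left_comm, queueStepLaw_succ_real hl hm, if_pos h0]
      ring
    · rw [← tsum_mul_left, ← tsum_mul_left,
        ← ((hS (y - 1)).mul_left l).tsum_add ((hS (y + 1)).mul_left m)]
      refine tsum_congr fun n => ?_
      rw [mul_left_comm, queueStepLaw_succ_real hl hm, if_neg h0]
      ring
  rw [queueLaw_real hl hm ν ht, queueLaw_real hl hm ν ht, queueLaw_real hl hm ν ht]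
  have e' : ∀ A E S : ℝ, E * -(l + m) * S + E * (A * (l + m)) = E * ((l + m) * A) - (l + m) * (E * S) := by
    intros; ring
  simp only [Function.comp_def]
  refine (e' _ _ _).trans ?_
  rw [e]
  split_ifs with h0
  · subst h0
    ring
  · ring

/-! ### The workload process -/

/-- Equilibrium workload of the M/M/1 queue with arrival rate `l` and service rate `m`: an atom of
mass `1 - l/m` at `0` and, with probability `l/m`, an exponential law of rate `m - l`. -/
def workloadEq (l m : ℝ) : Measure ℝ :=
  ENNReal.ofReal (1 - l / m) • Measure.dirac 0 + ENNReal.ofReal (l / m) • expMeasure (m - l)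

/-- The driving randomness: `(ω n).1` and `(ω n).2` are standard exponential variables, so that
with arrival rate `l` and service rate `m` the `n`-th interarrival time is `(ω n).1 / l` and the
service time of the `n`-th arriving customer is `(ω n).2 / m`. -/
abbrev Drive : Type := ℕ → ℝ × ℝ

instance isProbabilityMeasure_exp_one : IsProbabilityMeasure (expMeasure 1) :=
  isProbabilityMeasure_expMeasure one_pos

/-- All the interarrival and service times are independent. -/
def driveLaw : Measure Drive :=
  Measure.infinitePi fun _ : ℕ => (expMeasure 1).prod (expMeasure 1)

/-- `arrivalTime l ω n` is the time of the `n`-th arrival, for `n ≥ 1`; it is `0` for `n = 0`. -/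
def arrivalTime (l : ℝ) (ω : Drive) (n : ℕ) : ℝ :=
  ∑ i ∈ Finset.range n, (ω i).1 / l

/-- Workload just after the `n`-th arrival (the initial workload `w` for `n = 0`): between arrivals
it decreases at unit speed until it reaches `0`, and an arrival adds a service time to it. -/
def workloadAfter (l m w : ℝ) (ω : Drive) : ℕ → ℝ
  | 0 => w
  | n + 1 => max (workloadAfter l m w ω n - (ω n).1 / l) 0 + (ω n).2 / m

/-- Number of arrivals up to time `t`. -/
def arrivalCount (l t : ℝ) (ω : Drive) : ℕ :=
  sSup {n : ℕ | arrivalTime l ω n ≤ t}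

/-- Workload `W_t`: the time from `t` on until the queue is empty, not counting customers that
arrive after time `t`. -/
def workload (l m w t : ℝ) (ω : Drive) : ℝ :=
  max (workloadAfter l m w ω (arrivalCount l t ω) - (t - arrivalTime l ω (arrivalCount l t ω))) 0

lemma measurable_arrivalTime (l : ℝ) (n : ℕ) : Measurable fun ω : Drive => arrivalTime l ω n := by
  unfold arrivalTime
  fun_prop

lemma measurable_workloadAfter (l m : ℝ) (n : ℕ) :
    Measurable fun p : ℝ × Drive => workloadAfter l m p.1 p.2 n := by
  induction n with
  | zero => exact measurable_fst
  | succ n ih =>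
    simp only [workloadAfter]
    fun_prop

lemma measurable_arrivalCount (l t : ℝ) : Measurable fun ω : Drive => arrivalCount l t ω := by
  have h1 : ∀ k : ℕ, k ≠ 0 → MeasurableSet {ω : Drive | arrivalCount l t ω = k} := by
    intro k hk
    have : {ω : Drive | arrivalCount l t ω = k} =
        {ω | arrivalTime l ω k ≤ t} ∩ ⋂ (n : ℕ) (_ : k < n), {ω | t < arrivalTime l ω n} := by
      ext ω
      simp only [mem_ofPred_eq, mem_inter_iff, mem_iInter]
      constructor
      · intro h
        have hb : BddAbove {n : ℕ | arrivalTime l ω n ≤ t} := by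
          by_contra hb
          exact hk (h.symm.trans (Nat.sSup_of_not_bddAbove hb))
        have hne : {n : ℕ | arrivalTime l ω n ≤ t}.Nonempty := by
          by_contra hne
          rw [not_nonempty_iff_eq_empty] at hne
          rw [arrivalCount, hne] at h
          exact hk (by simpa using h.symm)
        refine ⟨?_, fun n hn => ?_⟩
        · have := Nat.sSup_mem hne hb
          rw [arrivalCount] at h
          rwa [h] at this
        · by_contra hc
          have := le_csSup hb (show n ∈ {n : ℕ | arrivalTime l ω n ≤ t} from not_lt.1 hc)
          rw [arrivalCount] at h
          omega
      · rintro ⟨h, h'⟩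
        refine IsGreatest.csSup_eq ⟨h, fun n hn => ?_⟩
        by_contra hc
        exact absurd (h' n (not_le.1 hc)) (not_lt.2 hn)
    rw [this]
    exact (measurableSet_le (measurable_arrivalTime l k) measurable_const).inter
      (MeasurableSet.iInter fun n => MeasurableSet.iInter fun _ =>
        measurableSet_lt measurable_const (measurable_arrivalTime l n))
  refine measurable_to_countable' fun k => ?_
  rcases eq_or_ne k 0 with rfl | hk
  · have : (fun ω : Drive => arrivalCount l t ω) ⁻¹' {0} =
        (⋃ (k : ℕ) (_ : k ≠ 0), {ω : Drive | arrivalCount l t ω = k})ᶜ := by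
      ext ω
      simp only [mem_preimage, mem_singleton_iff, mem_compl_iff, mem_iUnion, mem_ofPred_eq,
        exists_prop, not_exists, not_and]
      exact ⟨fun h i hi hc => hi (hc.symm.trans h), fun h => by_contra fun hc => h _ hc rfl⟩
    rw [this]
    exact (MeasurableSet.iUnion fun k => MeasurableSet.iUnion fun hk => h1 k hk).compl
  · exact h1 k hk

lemma measurable_workload (l m t : ℝ) :
    Measurable fun p : ℝ × Drive => workload l m p.1 t p.2 := by
  have hN : Measurable fun p : ℝ × Drive => arrivalCount l t p.2 :=
    (measurable_arrivalCount l t).comp measurable_snd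
  have h : ∀ n : ℕ, Measurable fun p : ℝ × Drive =>
      max (workloadAfter l m p.1 p.2 n - (t - arrivalTime l p.2 n)) 0 := fun n =>
    ((measurable_workloadAfter l m n).sub
      (measurable_const.sub ((measurable_arrivalTime l n).comp measurable_snd))).max
      measurable_const
  have hu : Measurable (Function.uncurry fun (n : ℕ) (p : ℝ × Drive) =>
      max (workloadAfter l m p.1 p.2 n - (t - arrivalTime l p.2 n)) 0) :=
    measurable_from_prod_countable_right h
  exact hu.comp (hN.prodMk measurable_id)

/-- Law at time `t ≥ 0` of the workload `W_t` of the M/M/1 queue with arrival rate `l`, service rate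
`m`, and initial workload of law `ν`, independent of later arrivals and their service times. -/
def workloadLaw (l m : ℝ) (ν : Measure ℝ) (t : ℝ) : Measure ℝ :=
  (ν.prod driveLaw).map fun p => workload l m p.1 t p.2

/-! ### The bounds -/

/-- `g(α) = (l + m - α - √((l + m - α)^2 - 4 l m)) / (2 l)`, for `α ≤ (√m - √l)^2`: the moment
generating function at `α` of the hitting time of `0` from queue length `1`. -/
def busyMGF (l m α : ℝ) : ℝ :=
  (l + m - α - √((l + m - α) ^ 2 - 4 * l * m)) / (2 * l)

/-- `G(α) = (1 - l0/m) / (1 - (l0/m) g(α))`, used only where `(l0/m) g(α) < 1`: the moment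
generating function at `α` of the hitting time of `0` from the equilibrium for arrival rate `l0`. -/
def boundConst (l0 l m α : ℝ) : ℝ :=
  (1 - l0 / m) / (1 - l0 / m * busyMGF l m α)

/-- The function `d` of time (a total variation distance to equilibrium) obeys the bounds for the
change of the arrival rate from `l0` to `l`, at service rate `m`. -/
def ArrivalChangeBounds (l0 l m : ℝ) (d : ℝ → ℝ) : Prop :=
  (l0 ≤ l → ∀ t, 0 ≤ t → d t ≤ (1 + √(l / m)) * exp (-(√m - √l) ^ 2 * t)) ∧
  (l < l0 → √(l * m) < l0 →
    0 < l + m - l0 - l * m / l0 ∧ l + m - l0 - l * m / l0 ≤ (√m - √l) ^ 2 ∧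
    ∀ α, 0 < α → α < l + m - l0 - l * m / l0 →
      l0 / m * busyMGF l m α < 1 ∧
      ∀ t, 0 ≤ t → d t ≤ boundConst l0 l m α * exp (-α * t)) ∧
  (l < l0 → l0 < √(l * m) →
    l0 / m * busyMGF l m ((√m - √l) ^ 2) < 1 ∧
    ∀ t, 0 ≤ t → d t ≤ boundConst l0 l m ((√m - √l) ^ 2) * exp (-(√m - √l) ^ 2 * t)) ∧
  (l < l0 → l0 = √(l * m) →
    ∃ C : ℝ, ∀ t, 0 ≤ t → d t ≤ C * exp (-(√m - √l) ^ 2 * t))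

end MM1

end

/-!
Everything is done with lower Lebesgue integrals of `ℝ≥0∞`-valued test functions.

*Queue length.* Write `K` for the operator `queueOp` of the embedded chain, so that the law at time
`t` is a Poisson mixture of the functionals `f ↦ ν (Kⁿ f)`. Two queues driven by the same epochs
keep their order, and have met once the larger one has been empty; hence, for `0 ≤ f ≤ 1`,
`Kⁿ f x ≤ Kⁿ f y + u n (max x y)`, where `u n x` (`busySurvival`) is the probability that the queue
started from `x` is not emptied within `n` epochs (`iterate_queueOp_le_add_busySurvival`). Geometric
laws of different parameters admit a monotone coupling (`exists_coupling_queueEq`) and the one for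
the current rates is invariant, so the distance to equilibrium is at most the Poisson mixture of the
means of `u n` under the larger equilibrium (`lintegral_queueLaw_le_add`). With
`θ = 1 - α / (l + m)` and `g = busyMGF l m α`, the function `θⁿ gˣ` dominates `u n x`; the geometric
mean of `gˣ` is `boundConst`, and the Poisson mean of `θⁿ` is `exp (-α t)`. When the arrival rate
changes from `l₀ = √(l m)` to `l`, the mean of `gˣ` is infinite at the critical `α`. There the mean
of `u n` is bounded directly: after weighting by the equilibrium the jumps become symmetric, and
summation over the starting point leaves a factor `2 √(l m) / (l + m)` per epoch
(`lintegral_busySurvival_critical_le`).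

*Workload.* Given the queue length `x`, the workload has the Erlang law `erlang m x`, at all times
if initially: `workloadLaw_bind_erlang`. Since a geometric mixture of Erlang laws is the workload
equilibrium (`bind_erlang_queueEq`), invariance and all bounds are inherited from the queue length,
as total variation does not increase under a transition kernel. Two probability measures are equal
as soon as one dominates the other, so for the intertwining it is enough to bound the workload law
from below. This follows by iterating a decomposition at the first epoch (`erlangOp_renewal`), that
is, at the minimum of the first arrival time and the service time of the customer at the front, by
the memorylessness of both (`two_clocks_until_le`).

*Change of both rates.* The embedded chain and the equilibria depend only on ratios of rates, and
the number of epochs up to time `t` only on `(l + m) t`.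
-/

noncomputable section

namespace MM1

/-! ### The transition operator of the queue length -/

/-- The one-epoch transition operator of the queue length, acting on test functions. -/
def queueOp (l m : ℝ) (f : ℕ → ℝ≥0∞) (x : ℕ) : ℝ≥0∞ := ∫⁻ y, f y ∂(queueStep l m x)

lemma queueOp_apply (l m : ℝ) (f : ℕ → ℝ≥0∞) (x : ℕ) :
    queueOp l m f x =
      ENNReal.ofReal (l / (l + m)) * f (x + 1) + ENNReal.ofReal (m / (l + m)) * f (x - 1) := by
  simp [queueOp, queueStep, lintegral_add_measure, lintegral_smul_measure]

lemma lintegral_queueStepLaw (l m : ℝ) (ν : Measure ℕ) (n : ℕ) (f : ℕ → ℝ≥0∞) :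
    ∫⁻ x, f x ∂(queueStepLaw l m ν n) = ∫⁻ x, (queueOp l m)^[n] f x ∂ν := by
  induction n generalizing f with
  | zero => rfl
  | succ n ih =>
    rw [queueStepLaw, Measure.lintegral_bind (by fun_prop) (by fun_prop),
      Function.iterate_succ_apply, ← ih]
    rfl

lemma lintegral_poissonMeasure (r : ℝ≥0) (f : ℕ → ℝ≥0∞) :
    ∫⁻ n, f n ∂(poissonMeasure r) = ∑' n, ENNReal.ofReal (exp (-r) * r ^ n / n !) * f n := by
  simp [poissonMeasure, lintegral_sum_measure, lintegral_smul_measure]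

lemma lintegral_queueLaw (l m t : ℝ) (ν : Measure ℕ) (f : ℕ → ℝ≥0∞) :
    ∫⁻ x, f x ∂(queueLaw l m ν t) =
      ∫⁻ n, ∫⁻ x, (queueOp l m)^[n] f x ∂ν ∂(poissonMeasure ((l + m) * t).toNNReal) := by
  rw [queueLaw, Measure.lintegral_bind (by fun_prop) (by fun_prop)]
  simp_rw [lintegral_queueStepLaw]

lemma isProbabilityMeasure_queueLaw {l m : ℝ} (hl : 0 < l) (hm : 0 < m) (ν : Measure ℕ)
    [IsProbabilityMeasure ν] (t : ℝ) : IsProbabilityMeasure (queueLaw l m ν t) := by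
  constructor
  have := isProbabilityMeasure_queueStepLaw hl hm ν
  rw [queueLaw, Measure.bind_apply MeasurableSet.univ (by fun_prop)]
  simp

/-! ### Geometric equilibria -/

lemma lintegral_queueEq (l m : ℝ) (f : ℕ → ℝ≥0∞) :
    ∫⁻ x, f x ∂(queueEq l m) = ∑' x, ENNReal.ofReal ((1 - l / m) * (l / m) ^ x) * f x := by
  simp [queueEq, lintegral_sum_measure, lintegral_smul_measure]

lemma tsum_geometric_tail {r : ℝ} (h0 : 0 ≤ r) (h1 : r < 1) (k : ℕ) :
    ∑' i : ℕ, ENNReal.ofReal ((1 - r) * r ^ (i + k)) = ENNReal.ofReal (r ^ k) := by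
  have h2 : 0 < 1 - r := by linarith
  rw [← ENNReal.ofReal_tsum_of_nonneg (fun i => by positivity)
    (((summable_nat_add_iff k).2 (summable_geometric_of_lt_one h0 h1)).mul_left _), tsum_mul_left]
  simp_rw [pow_add]
  rw [tsum_mul_right, tsum_geometric_of_lt_one h0 h1]
  field_simp

lemma queueEq_Ici {l m : ℝ} (hl : 0 < l) (hlm : l < m) (k : ℕ) :
    queueEq l m (Ici k) = ENNReal.ofReal ((l / m) ^ k) := by
  have hm : 0 < m := hl.trans hlm
  have h : queueEq l m (Ici k) = ∫⁻ x, (Ici k).indicator 1 x ∂(queueEq l m) :=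
    (lintegral_indicator_one measurableSet_Ici).symm
  have hr : 0 ≤ l / m := by positivity
  rw [h, lintegral_queueEq, ← tsum_geometric_tail hr ((div_lt_one hm).2 hlm) k]
  set F : ℕ → ℝ≥0∞ := fun x =>
    ENNReal.ofReal ((1 - l / m) * (l / m) ^ x) * (Ici k).indicator 1 x with hF
  have h0 : ∑ i ∈ Finset.range k, F i = 0 := Finset.sum_eq_zero fun i hi => by
    simp only [hF]
    rw [indicator_of_notMem (by simpa using Finset.mem_range.1 hi), mul_zero]
  calc ∑' x, F x = ∑ i ∈ Finset.range k, F i + ∑' i, F (i + k) :=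
        (ENNReal.summable.sum_add_tsum_nat_add' ).symm
    _ = ∑' i, F (i + k) := by rw [h0, zero_add]
    _ = _ := tsum_congr fun i => by
        simp only [hF]
        rw [indicator_of_mem (by simp), Pi.one_apply, mul_one]

lemma isProbabilityMeasure_queueEq {l m : ℝ} (hl : 0 < l) (hlm : l < m) :
    IsProbabilityMeasure (queueEq l m) := by
  constructor
  have h := queueEq_Ici hl hlm 0
  rwa [pow_zero, ENNReal.ofReal_one, ← bot_eq_zero, Ici_bot] at h

lemma queueEq_real_singleton {l m : ℝ} (hl : 0 < l) (hlm : l < m) (y : ℕ) :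
    (queueEq l m).real {y} = (1 - l / m) * (l / m) ^ y := by
  have hm : 0 < m := hl.trans hlm
  have hr : l / m < 1 := (div_lt_one hm).2 hlm
  rw [measureReal_def, queueEq, Measure.sum_smul_dirac_singleton, ENNReal.toReal_ofReal]
  exact mul_nonneg (by linarith) (by positivity)

/-- Geometric laws are invariant for the embedded jump chain, by detailed balance. -/
lemma queueStepLaw_queueEq {l m : ℝ} (hl : 0 < l) (hlm : l < m) (n : ℕ) :
    queueStepLaw l m (queueEq l m) n = queueEq l m := by
  have hm : 0 < m := hl.trans hlm
  have := isProbabilityMeasure_queueEq hl hlm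
  induction n with
  | zero => rfl
  | succ n ih =>
    have := isProbabilityMeasure_queueStepLaw hl hm (queueEq l m) (n + 1)
    refine Measure.ext_of_singleton fun y => ?_
    rw [← measureReal_eq_measureReal_iff]
    have h := queueStepLaw_succ_real hl hm (queueEq l m) n y
    simp only [ih, queueEq_real_singleton hl hlm] at h
    rw [queueEq_real_singleton hl hlm]
    refine mul_left_cancel₀ (by positivity : l + m ≠ 0) (h.trans ?_)
    have e : m * (l / m) = l := by field_simp
    rcases y with _ | y
    · simp only [if_true]
      linear_combination (1 - l / m) * e
    · simp only [Nat.add_one_ne_zero, if_false, Nat.add_sub_cancel]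
      linear_combination ((1 - l / m) * (l / m) ^ (y + 1) - (1 - l / m) * (l / m) ^ y) * e

lemma queueLaw_queueEq {l m : ℝ} (hl : 0 < l) (hlm : l < m) (t : ℝ) :
    queueLaw l m (queueEq l m) t = queueEq l m := by
  have : queueStepLaw l m (queueEq l m) = fun _ => queueEq l m :=
    funext (queueStepLaw_queueEq hl hlm)
  rw [queueLaw, this, Measure.bind_const, measure_univ, one_smul]

/-- Monotone coupling of two equilibria: if `X` and `Z` are independent with laws `queueEq l₂ m`
and `queueEq l₁ l₂`, then `min X Z` has law `queueEq l₁ m`. -/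
lemma exists_coupling_queueEq {l₁ l₂ m : ℝ} (h₁ : 0 < l₁) (h₁₂ : l₁ ≤ l₂) (h₂ : l₂ < m) :
    ∃ γ : Measure (ℕ × ℕ), γ.map Prod.fst = queueEq l₁ m ∧ γ.map Prod.snd = queueEq l₂ m ∧
      ∀ᵐ p ∂γ, p.1 ≤ p.2 := by
  have hp₂ := isProbabilityMeasure_queueEq (h₁.trans_le h₁₂) h₂
  rcases h₁₂.eq_or_lt with rfl | h
  · refine ⟨(queueEq l₁ m).map fun x => (x, x), ?_, ?_, ?_⟩
    · rw [Measure.map_map (by fun_prop) (by fun_prop)]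
      exact Measure.map_id
    · rw [Measure.map_map (by fun_prop) (by fun_prop)]
      exact Measure.map_id
    · rw [ae_map_iff (by fun_prop) (by measurability)]
      simp
  · have hl₂ : 0 < l₂ := h₁.trans h
    have hm : 0 < m := hl₂.trans h₂
    have hp := isProbabilityMeasure_queueEq h₁ h
    have hp₁ := isProbabilityMeasure_queueEq h₁ (h.trans h₂)
    refine ⟨((queueEq l₂ m).prod (queueEq l₁ l₂)).map fun p => (min p.1 p.2, p.1), ?_, ?_, ?_⟩
    · rw [Measure.map_map (by fun_prop) (by fun_prop)]
      have := Measure.isProbabilityMeasure_map (μ := (queueEq l₂ m).prod (queueEq l₁ l₂))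
        (f := Prod.fst ∘ fun p : ℕ × ℕ => (min p.1 p.2, p.1)) (by fun_prop)
      refine Measure.ext_of_Ici _ _ fun k => ?_
      rw [Measure.map_apply (by fun_prop) measurableSet_Ici]
      have : (Prod.fst ∘ fun p : ℕ × ℕ => (min p.1 p.2, p.1)) ⁻¹' Ici k = Ici k ×ˢ Ici k := by
        ext p
        simp only [mem_preimage, Function.comp_apply, mem_Ici, le_min_iff, mem_prod]
      rw [this, Measure.prod_prod, queueEq_Ici (h₁.trans h) h₂, queueEq_Ici h₁ h,
        queueEq_Ici h₁ (h.trans h₂), ← ENNReal.ofReal_mul (by positivity), ← mul_pow]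
      congr 2
      field_simp
    · rw [Measure.map_map (by fun_prop) (by fun_prop)]
      have : (Prod.snd ∘ fun p : ℕ × ℕ => (min p.1 p.2, p.1)) = Prod.fst := rfl
      rw [this, Measure.map_fst_prod, measure_univ, one_smul]
    · rw [ae_map_iff (by fun_prop) (by measurability)]
      simp

lemma lintegral_queueEq_le_add {l₁ l₂ m : ℝ} (h₁ : 0 < l₁) (h₁₂ : l₁ ≤ l₂) (h₂ : l₂ < m)
    {f u : ℕ → ℝ≥0∞} (h : ∀ x y, f x ≤ f y + u (max x y)) :
    ∫⁻ x, f x ∂(queueEq l₁ m) ≤ ∫⁻ x, f x ∂(queueEq l₂ m) + ∫⁻ x, u x ∂(queueEq l₂ m) ∧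
    ∫⁻ x, f x ∂(queueEq l₂ m) ≤ ∫⁻ x, f x ∂(queueEq l₁ m) + ∫⁻ x, u x ∂(queueEq l₂ m) := by
  obtain ⟨γ, hγ₁, hγ₂, hle⟩ := exists_coupling_queueEq h₁ h₁₂ h₂
  rw [← hγ₁, ← hγ₂, lintegral_map (by fun_prop) (by fun_prop),
    lintegral_map (by fun_prop) (by fun_prop), lintegral_map (by fun_prop) (by fun_prop),
    ← lintegral_add_left (by fun_prop), ← lintegral_add_left (by fun_prop)]
  constructor
  · refine lintegral_mono_ae (hle.mono fun p hp => ?_)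
    simpa [max_eq_right hp] using h p.1 p.2
  · refine lintegral_mono_ae (hle.mono fun p hp => ?_)
    simpa [max_eq_left hp] using h p.2 p.1

/-! ### Coupling until the larger queue is empty -/

/-- The probability that the queue length, started from `x`, is positive initially and after each
of the first `n` epochs. -/
def busySurvival (l m : ℝ) : ℕ → ℕ → ℝ≥0∞
  | 0, x => if x = 0 then 0 else 1
  | n + 1, x => if x = 0 then 0 else queueOp l m (busySurvival l m n) x

/-- Two queues driven by the same epochs have met once the larger one has been empty. -/
lemma iterate_queueOp_le_add_busySurvival {l m : ℝ} {f : ℕ → ℝ≥0∞} (hf : ∀ x, f x ≤ 1)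
    (n x y : ℕ) :
    (queueOp l m)^[n] f x ≤ (queueOp l m)^[n] f y + busySurvival l m n (max x y) := by
  induction n generalizing x y with
  | zero =>
    rcases eq_or_ne (max x y) 0 with h | h
    · obtain ⟨rfl, rfl⟩ : x = 0 ∧ y = 0 := by omega
      exact le_self_add
    · simp only [Function.iterate_zero, id_eq, busySurvival, if_neg h]
      exact (hf x).trans le_add_self
  | succ n ih =>
    rcases eq_or_ne (max x y) 0 with h | h
    · obtain ⟨rfl, rfl⟩ : x = 0 ∧ y = 0 := by omega
      exact le_self_add
    · simp only [Function.iterate_succ_apply', busySurvival, if_neg h, queueOp_apply]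
      have h₁ := ih (x + 1) (y + 1)
      have h₂ := ih (x - 1) (y - 1)
      rw [show max (x + 1) (y + 1) = max x y + 1 by omega] at h₁
      rw [show max (x - 1) (y - 1) = max x y - 1 by omega] at h₂
      calc _ ≤ ENNReal.ofReal (l / (l + m)) * ((queueOp l m)^[n] f (y + 1) +
              busySurvival l m n (max x y + 1)) +
            ENNReal.ofReal (m / (l + m)) * ((queueOp l m)^[n] f (y - 1) +
              busySurvival l m n (max x y - 1)) := by gcongr
        _ = _ := by ring

lemma lintegral_poissonMeasure_pow {r θ C : ℝ} (hr : 0 ≤ r) (hθ : 0 ≤ θ) (hC : 0 ≤ C) :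
    ∫⁻ n, ENNReal.ofReal (C * θ ^ n) ∂(poissonMeasure r.toNNReal) =
      ENNReal.ofReal (C * exp (-((1 - θ) * r))) := by
  have hs : HasSum (fun n : ℕ => C * exp (-r) * ((r * θ) ^ n / n !))
      (C * exp (-r) * exp (r * θ)) := by
    rw [exp_eq_exp_ℝ]
    exact (NormedSpace.expSeries_div_hasSum_exp (r * θ)).mul_left _
  have e : ∀ n : ℕ, ENNReal.ofReal (exp (-r) * r ^ n / n !) * ENNReal.ofReal (C * θ ^ n) =
      ENNReal.ofReal (C * exp (-r) * ((r * θ) ^ n / n !)) := by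
    intro n
    rw [← ENNReal.ofReal_mul (by positivity), mul_pow]
    congr 1
    ring
  rw [lintegral_poissonMeasure]
  simp_rw [Real.coe_toNNReal _ hr, e]
  rw [← ENNReal.ofReal_tsum_of_nonneg (fun n => by positivity) hs.summable, hs.tsum_eq, mul_assoc,
    ← exp_add]
  congr 3
  ring

/-- If the probability of no visit to `0` in `n` epochs from the larger of two equilibria is at
most `C θ^n`, then the queue started from the equilibrium for `l₀` approaches its own equilibrium
at the exponential rate `(1 - θ) (l + m)`, uniformly over test functions with values in `[0, 1]`. -/
lemma lintegral_queueLaw_le_add {l₀ l m C θ t : ℝ} (h₀ : 0 < l₀) (hl : 0 < l) (h₀m : l₀ < m)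
    (hlm : l < m) (hC : 0 ≤ C) (hθ : 0 ≤ θ) (ht : 0 ≤ t)
    (hS : ∀ n, ∫⁻ x, busySurvival l m n x ∂(queueEq (max l₀ l) m) ≤ ENNReal.ofReal (C * θ ^ n))
    {f : ℕ → ℝ≥0∞} (hf : ∀ x, f x ≤ 1) :
    ∫⁻ x, f x ∂(queueLaw l m (queueEq l₀ m) t) ≤ ∫⁻ x, f x ∂(queueEq l m) +
      ENNReal.ofReal (C * exp (-((1 - θ) * ((l + m) * t)))) ∧
    ∫⁻ x, f x ∂(queueEq l m) ≤ ∫⁻ x, f x ∂(queueLaw l m (queueEq l₀ m) t) +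
      ENNReal.ofReal (C * exp (-((1 - θ) * ((l + m) * t)))) := by
  have hm : 0 < m := hl.trans hlm
  have key : ∀ n, ∫⁻ x, (queueOp l m)^[n] f x ∂(queueEq l₀ m) ≤
        ∫⁻ x, (queueOp l m)^[n] f x ∂(queueEq l m) + ENNReal.ofReal (C * θ ^ n) ∧
      ∫⁻ x, (queueOp l m)^[n] f x ∂(queueEq l m) ≤
        ∫⁻ x, (queueOp l m)^[n] f x ∂(queueEq l₀ m) + ENNReal.ofReal (C * θ ^ n) := by
    intro n
    have hc := iterate_queueOp_le_add_busySurvival (l := l) (m := m) hf n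
    rcases le_total l₀ l with h | h
    · have h' := lintegral_queueEq_le_add h₀ h hlm hc
      have hS' := hS n
      rw [max_eq_right h] at hS'
      exact ⟨h'.1.trans (by gcongr), h'.2.trans (by gcongr)⟩
    · have h' := lintegral_queueEq_le_add hl h h₀m hc
      have hS' := hS n
      rw [max_eq_left h] at hS'
      exact ⟨h'.2.trans (by gcongr), h'.1.trans (by gcongr)⟩
  rw [← queueLaw_queueEq hl hlm t, lintegral_queueLaw, lintegral_queueLaw,
    ← lintegral_poissonMeasure_pow (by positivity) hθ hC, ← lintegral_add_left (by fun_prop),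
    ← lintegral_add_left (by fun_prop)]
  exact ⟨lintegral_mono fun n => (key n).1, lintegral_mono fun n => (key n).2⟩

/-! ### Exponential bounds for the time to empty the queue -/

/-- If `l g² + m = θ (l + m) g`, then `θ⁻ⁿ gˣ` is a martingale until the queue is empty. -/
lemma busySurvival_le {l m g θ : ℝ} (hl : 0 < l) (hm : 0 < m) (hg : 1 ≤ g) (hθ : 0 ≤ θ)
    (h : l * g ^ 2 + m = θ * (l + m) * g) (n x : ℕ) :
    busySurvival l m n x ≤ ENNReal.ofReal (θ ^ n * g ^ x) := by
  induction n generalizing x with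
  | zero =>
    rw [busySurvival, pow_zero, one_mul, ← ENNReal.ofReal_one]
    split_ifs
    · exact zero_le
    · exact ENNReal.ofReal_le_ofReal (one_le_pow₀ hg)
  | succ n ih =>
    rcases x with _ | x
    · simp [busySurvival]
    · rw [busySurvival, if_neg (by omega), queueOp_apply, Nat.add_sub_cancel]
      refine (add_le_add (mul_le_mul_right (ih _) _) (mul_le_mul_right (ih _) _)).trans ?_
      have hg0 : 0 < g := by linarith
      rw [← ENNReal.ofReal_mul (by positivity), ← ENNReal.ofReal_mul (by positivity),
        ← ENNReal.ofReal_add (by positivity) (by positivity)]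
      refine (congrArg ENNReal.ofReal ?_).le
      have e : l / (l + m) * (θ ^ n * g ^ (x + 1 + 1)) + m / (l + m) * (θ ^ n * g ^ x) =
          θ ^ n * g ^ x * (l * g ^ 2 + m) / (l + m) := by
        field_simp
        ring
      rw [e, h]
      field_simp
      ring

lemma lintegral_pow_queueEq {l₀ m g : ℝ} (h₀ : 0 < l₀) (hm : l₀ < m) (hg : 0 ≤ g)
    (h : l₀ / m * g < 1) {c : ℝ} (hc : 0 ≤ c) :
    ∫⁻ x, ENNReal.ofReal (c * g ^ x) ∂(queueEq l₀ m) =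
      ENNReal.ofReal ((1 - l₀ / m) / (1 - l₀ / m * g) * c) := by
  have hm0 : 0 < m := h₀.trans hm
  have hr : 0 < 1 - l₀ / m := sub_pos.2 ((div_lt_one hm0).2 hm)
  have hr0 : 0 ≤ l₀ / m * g := by positivity
  have e : ∀ x : ℕ, ENNReal.ofReal ((1 - l₀ / m) * (l₀ / m) ^ x) * ENNReal.ofReal (c * g ^ x) =
      ENNReal.ofReal ((1 - l₀ / m) * c * (l₀ / m * g) ^ x) := by
    intro x
    rw [← ENNReal.ofReal_mul (by positivity), mul_pow]
    congr 1
    ring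
  rw [lintegral_queueEq]
  simp_rw [e]
  rw [← ENNReal.ofReal_tsum_of_nonneg (fun x => by positivity)
    ((summable_geometric_of_lt_one hr0 h).mul_left _), tsum_mul_left,
    tsum_geometric_of_lt_one hr0 h]
  congr 1
  ring

/-- At the critical rate `l₀ = √(l m)` the moment generating function of the emptying time is
infinite at its critical exponent. Weighting by the equilibrium `r ^ x` with `r ^ 2 = l / m` makes
the jumps symmetric up to the factor `2 √(l m) / (l + m)`, and killing at `0` loses mass. -/
lemma lintegral_busySurvival_critical_le {a b : ℝ} (ha : 0 < a) (hab : a < b) (n : ℕ) :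
    ∫⁻ x, busySurvival (a ^ 2) (b ^ 2) n x ∂(queueEq (a * b) (b ^ 2)) ≤
      ENNReal.ofReal (1 * (2 * a * b / (a ^ 2 + b ^ 2)) ^ n) := by
  have hb : 0 < b := ha.trans hab
  have hr : a * b / b ^ 2 = a / b := by field_simp
  have hr1 : 0 < 1 - a / b := sub_pos.2 ((div_lt_one hb).2 hab)
  set κ : ℝ := a * b / (a ^ 2 + b ^ 2) with hκ
  set w : ℕ → ℝ≥0∞ := fun x => ENNReal.ofReal ((1 - a / b) * (a / b) ^ x) with hw
  have hint : ∀ f : ℕ → ℝ≥0∞,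
      ∫⁻ x, f x ∂(queueEq (a * b) (b ^ 2)) = ∑' x, w x * f x := fun f => by
    rw [lintegral_queueEq, hr]
  have hup : ∀ x, w x * ENNReal.ofReal (a ^ 2 / (a ^ 2 + b ^ 2)) =
      ENNReal.ofReal κ * w (x + 1) := fun x => by
    simp only [hw, hκ]
    rw [← ENNReal.ofReal_mul (by positivity), ← ENNReal.ofReal_mul (by positivity),
      pow_succ (a / b) x]
    congr 1
    field_simp
  have hdown : ∀ x, w (x + 1) * ENNReal.ofReal (b ^ 2 / (a ^ 2 + b ^ 2)) =
      ENNReal.ofReal κ * w x := fun x => by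
    simp only [hw, hκ]
    rw [← ENNReal.ofReal_mul (by positivity), ← ENNReal.ofReal_mul (by positivity),
      pow_succ (a / b) x]
    congr 1
    field_simp
  induction n with
  | zero =>
    have := isProbabilityMeasure_queueEq (by positivity : 0 < a * b)
      (by rw [pow_two]; gcongr : a * b < b ^ 2)
    calc _ ≤ ∫⁻ _, 1 ∂(queueEq (a * b) (b ^ 2)) := lintegral_mono fun x => by
          rw [busySurvival]
          split_ifs <;> simp
      _ = _ := by simp
  | succ n ih =>
    rw [hint] at ih ⊢
    set S := busySurvival (a ^ 2) (b ^ 2) n with hS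
    have hsucc : ∀ x, w (x + 1) * busySurvival (a ^ 2) (b ^ 2) (n + 1) (x + 1) =
        ENNReal.ofReal κ * (w (x + 2) * S (x + 2)) + ENNReal.ofReal κ * (w x * S x) := fun x => by
      rw [busySurvival, if_neg (by omega), queueOp_apply, mul_add, ← mul_assoc, ← mul_assoc, hup,
        Nat.add_sub_cancel, hdown]
      ring
    have hshift : ∀ k, ∑' x, w (x + k) * S (x + k) ≤ ∑' x, w x * S x := fun k =>
      ENNReal.tsum_comp_le_tsum_of_injective (add_left_injective k) fun x => w x * S x
    rw [tsum_eq_zero_add' ENNReal.summable]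
    simp_rw [hsucc]
    rw [ENNReal.tsum_add, ENNReal.tsum_mul_left, ENNReal.tsum_mul_left]
    have hzero : w 0 * busySurvival (a ^ 2) (b ^ 2) (n + 1) 0 = 0 := by simp [busySurvival]
    rw [hzero, zero_add]
    calc _ ≤ ENNReal.ofReal κ * ENNReal.ofReal (1 * (2 * a * b / (a ^ 2 + b ^ 2)) ^ n) +
          ENNReal.ofReal κ * ENNReal.ofReal (1 * (2 * a * b / (a ^ 2 + b ^ 2)) ^ n) := by
          gcongr
          exact (hshift 2).trans ih
      _ = _ := by
          rw [← ENNReal.ofReal_mul (by positivity), ← ENNReal.ofReal_add (by positivity)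
            (by positivity), pow_succ]
          congr 1
          rw [hκ]
          ring

/-! ### The smaller root `busyMGF` -/

lemma two_mul_sqrt_mul_sqrt_le {l m α : ℝ} (hl : 0 < l) (hm : 0 < m) (hα : α ≤ (√m - √l) ^ 2) :
    2 * (√m * √l) ≤ l + m - α := by
  nlinarith [sq_sqrt hl.le, sq_sqrt hm.le]

lemma busyMGF_root {l m α : ℝ} (hl : 0 < l) (hm : 0 < m) (hα : α ≤ (√m - √l) ^ 2) :
    l * busyMGF l m α ^ 2 + m = (l + m - α) * busyMGF l m α := by
  have h := two_mul_sqrt_mul_sqrt_le hl hm hα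
  have hD : 0 ≤ (l + m - α) ^ 2 - 4 * l * m := by
    have h1 : (2 * (√m * √l)) ^ 2 ≤ (l + m - α) ^ 2 := by gcongr
    have h2 : (2 * (√m * √l)) ^ 2 = 4 * l * m := by
      rw [mul_pow, mul_pow, sq_sqrt hl.le, sq_sqrt hm.le]
      ring
    linarith
  have hs := sq_sqrt hD
  rw [busyMGF]
  set s := √((l + m - α) ^ 2 - 4 * l * m)
  field_simp
  linear_combination hs

/-- For `0 ≤ α` the polynomial `l g² - (l + m - α) g + m` is nonnegative at `g = 1`, to the left of
its vertex. -/
lemma one_le_busyMGF {l m α : ℝ} (hl : 0 < l) (hlm : l < m) (h0 : 0 ≤ α)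
    (hα : α ≤ (√m - √l) ^ 2) : 1 ≤ busyMGF l m α := by
  have hm := hl.trans hlm
  have h := two_mul_sqrt_mul_sqrt_le hl hm hα
  have h1 : √l ≤ √m := sqrt_le_sqrt hlm.le
  have h2 : 0 ≤ l + m - α - 2 * l := by nlinarith [sq_sqrt hl.le, sqrt_nonneg l]
  have h3 : √((l + m - α) ^ 2 - 4 * l * m) ≤ l + m - α - 2 * l :=
    Real.sqrt_le_iff.2 ⟨h2, by nlinarith⟩
  rw [busyMGF, le_div_iff₀ (by positivity)]
  linarith

/-- The bound on `α` says that the quadratic polynomial `l g² - (l + m - α) g + m` is negative at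
`g = m / l₀`, which therefore lies above its smaller root. -/
lemma busyMGF_lt {l₀ l m α : ℝ} (h₀ : 0 < l₀) (hl : 0 < l) (hm : 0 < m)
    (hα : α < l + m - l₀ - l * m / l₀) : l₀ / m * busyMGF l m α < 1 := by
  set k := l * m / l₀ with hk
  have hk0 : 0 < k := by positivity
  have hkl : k * l₀ = l * m := by rw [hk]; field_simp
  have h : l + m - α - 2 * k < √((l + m - α) ^ 2 - 4 * l * m) := by
    refine Real.lt_sqrt_of_sq_lt ?_
    nlinarith
  have h2 : busyMGF l m α < m / l₀ := by
    rw [busyMGF, div_lt_iff₀ (by positivity)]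
    have : m / l₀ * (2 * l) = 2 * k := by rw [hk]; ring
    linarith
  calc l₀ / m * busyMGF l m α < l₀ / m * (m / l₀) := by gcongr
    _ = 1 := by field_simp

lemma busyMGF_critical {l m : ℝ} (hl : 0 < l) (hm : 0 < m) :
    busyMGF l m ((√m - √l) ^ 2) = √m / √l := by
  have ha := sq_sqrt hl.le
  have hb := sq_sqrt hm.le
  have ha0 : 0 < √l := sqrt_pos.2 hl
  have hD : (l + m - (√m - √l) ^ 2) ^ 2 - 4 * l * m = 0 := by
    have : l + m - (√m - √l) ^ 2 = 2 * √m * √l := by linear_combination -ha - hb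
    rw [this, mul_pow, mul_pow, ha, hb]
    ring
  rw [busyMGF, hD, sqrt_zero, div_eq_div_iff (by positivity) (by positivity)]
  linear_combination (2 * √m - √l) * ha - √l * hb

/-! ### From the queue length to total variation bounds -/

/-- `P` and `Q` differ by at most `B` on test functions with values in `[0, 1]`. -/
def CloseOnTests (P Q : Measure ℕ) (B : ℝ) : Prop :=
  ∀ f : ℕ → ℝ≥0∞, (∀ x, f x ≤ 1) →
    ∫⁻ x, f x ∂P ≤ ∫⁻ x, f x ∂Q + ENNReal.ofReal B ∧
    ∫⁻ x, f x ∂Q ≤ ∫⁻ x, f x ∂P + ENNReal.ofReal B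

/-- Total variation does not increase under a transition kernel out of `ℕ`. -/
lemma CloseOnTests.tvDist_bind_le {Ω : Type*} [MeasurableSpace Ω] {P Q : Measure ℕ} {B : ℝ}
    (h : CloseOnTests P Q B) (hB : 0 ≤ B) (κ : ℕ → Measure Ω) [∀ x, IsProbabilityMeasure (κ x)]
    [IsProbabilityMeasure P] [IsProbabilityMeasure Q] :
    tvDist (P.bind κ) (Q.bind κ) ≤ B := by
  have : Nonempty {A : Set Ω // MeasurableSet A} := ⟨⟨∅, MeasurableSet.empty⟩⟩
  refine ciSup_le fun A => ?_
  have hfin : ∀ ν : Measure ℕ, IsProbabilityMeasure ν → (ν.bind κ) A.1 ≠ ∞ := fun ν _ => by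
    rw [Measure.bind_apply A.2 (by fun_prop)]
    refine ne_top_of_le_ne_top ENNReal.one_ne_top ?_
    calc _ ≤ ∫⁻ _, 1 ∂ν := lintegral_mono fun x => prob_le_one
      _ = 1 := by simp
  have h' := h (fun x => κ x A.1) fun x => prob_le_one
  rw [← Measure.bind_apply A.2 (by fun_prop), ← Measure.bind_apply A.2 (by fun_prop)] at h'
  have toReal : ∀ x y : ℝ≥0∞, x ≠ ∞ → y ≠ ∞ → x ≤ y + ENNReal.ofReal B →
      x.toReal ≤ y.toReal + B := fun x y _ hy hxy => by
    have := ENNReal.toReal_mono (by finiteness) hxy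
    rwa [ENNReal.toReal_add hy (by finiteness), ENNReal.toReal_ofReal hB] at this
  have h1 := toReal _ _ (hfin P ‹_›) (hfin Q ‹_›) h'.1
  have h2 := toReal _ _ (hfin Q ‹_›) (hfin P ‹_›) h'.2
  rw [measureReal_def, measureReal_def, abs_le]
  constructor <;> linarith

/-- The bound by the moment generating function of the time at which the queue started from the
larger of the two equilibria is empty. -/
lemma closeOnTests_of_busyMGF {l₀ l m α t : ℝ} (h₀ : 0 < l₀) (hl : 0 < l) (h₀m : l₀ < m)
    (hlm : l < m) (hα0 : 0 ≤ α) (hα : α ≤ (√m - √l) ^ 2)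
    (h : max l₀ l / m * busyMGF l m α < 1) (ht : 0 ≤ t) :
    0 ≤ boundConst (max l₀ l) l m α ∧
    CloseOnTests (queueLaw l m (queueEq l₀ m) t) (queueEq l m)
      (boundConst (max l₀ l) l m α * exp (-α * t)) := by
  have hm := hl.trans hlm
  have hmax : 0 < max l₀ l := lt_max_of_lt_left h₀
  have hmaxm : max l₀ l < m := max_lt h₀m hlm
  have hg := one_le_busyMGF hl hlm hα0 hα
  have hC : 0 ≤ boundConst (max l₀ l) l m α :=
    div_nonneg (sub_nonneg.2 ((div_le_one hm).2 hmaxm.le)) (sub_nonneg.2 h.le)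
  refine ⟨hC, fun f hf => ?_⟩
  set θ := 1 - α / (l + m) with hθ
  have hθ0 : 0 ≤ θ := by
    rw [hθ, sub_nonneg, div_le_one (by positivity)]
    have := two_mul_sqrt_mul_sqrt_le hl hm hα
    have : 0 ≤ √m * √l := by positivity
    linarith
  have hroot : l * busyMGF l m α ^ 2 + m = θ * (l + m) * busyMGF l m α := by
    rw [busyMGF_root hl hm hα, hθ]
    field_simp
  have hS : ∀ n, ∫⁻ x, busySurvival l m n x ∂(queueEq (max l₀ l) m) ≤
      ENNReal.ofReal (boundConst (max l₀ l) l m α * θ ^ n) := fun n => by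
    rw [boundConst, ← lintegral_pow_queueEq hmax hmaxm (by linarith) h (by positivity)]
    exact lintegral_mono fun x => busySurvival_le hl hm hg hθ0 hroot n x
  have e : -((1 - θ) * ((l + m) * t)) = -α * t := by
    rw [hθ]
    field_simp
    ring
  rw [← e]
  exact lintegral_queueLaw_le_add h₀ hl h₀m hlm hC hθ0 ht hS hf

/-- Every quantity dominated by the distance of queue-length laws on test functions obeys the
bounds. -/
lemma arrivalChangeBounds_of_closeOnTests {l₀ l m : ℝ} (h₀ : 0 < l₀) (hl : 0 < l) (h₀m : l₀ < m)
    (hlm : l < m) {d : ℝ → ℝ}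
    (hd : ∀ t, 0 ≤ t → ∀ B, 0 ≤ B →
      CloseOnTests (queueLaw l m (queueEq l₀ m) t) (queueEq l m) B → d t ≤ B) :
    ArrivalChangeBounds l₀ l m d := by
  have hm := hl.trans hlm
  have ha := sq_sqrt hl.le
  have hb := sq_sqrt hm.le
  have ha0 : 0 < √l := sqrt_pos.2 hl
  have hb0 : 0 < √m := sqrt_pos.2 hm
  have hab : √l < √m := sqrt_lt_sqrt hl.le hlm
  have hsq : √(l * m) = √l * √m := sqrt_mul hl.le m
  have hmgf : ∀ α, 0 ≤ α → α ≤ (√m - √l) ^ 2 → max l₀ l / m * busyMGF l m α < 1 →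
      ∀ t, 0 ≤ t → d t ≤ boundConst (max l₀ l) l m α * exp (-α * t) := by
    intro α hα0 hα h t ht
    obtain ⟨hC, hclose⟩ := closeOnTests_of_busyMGF h₀ hl h₀m hlm hα0 hα h ht
    exact hd t ht _ (by positivity) hclose
  have hle : l + m - l₀ - l * m / l₀ ≤ (√m - √l) ^ 2 := by
    have : 2 * (√l * √m) ≤ l₀ + l * m / l₀ := by
      have e : l₀ + l * m / l₀ - 2 * (√l * √m) = (l₀ - √l * √m) ^ 2 / l₀ := by
        rw [← ha, ← hb]
        simp only [sqrt_sq ha0.le, sqrt_sq hb0.le]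
        field_simp
        ring
      have : 0 ≤ (l₀ - √l * √m) ^ 2 / l₀ := by positivity
      linarith
    nlinarith
  refine ⟨fun h t ht => ?_, fun h hlt => ⟨?_, hle, fun α hα0 hα => ?_⟩, fun h hlt => ?_,
    fun h heq => ⟨1, fun t ht => ?_⟩⟩
  · have hg : l / m * busyMGF l m ((√m - √l) ^ 2) = √l / √m := by
      rw [busyMGF_critical hl hm]
      nth_rw 1 [← ha]
      nth_rw 1 [← hb]
      field_simp
    have h1 : √l / √m < 1 := (div_lt_one hb0).2 hab
    have := hmgf _ (sq_nonneg _) le_rfl (by rw [max_eq_right h, hg]; exact h1) t ht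
    rw [max_eq_right h, boundConst, hg] at this
    have e : (1 - l / m) / (1 - √l / √m) = 1 + √(l / m) := by
      rw [sqrt_div hl.le, div_eq_iff (by linarith)]
      nth_rw 1 [← ha]
      nth_rw 1 [← hb]
      field_simp
      ring
    rwa [e] at this
  · have e : l + m - l₀ - l * m / l₀ = (l₀ - l) * (m - l₀) / l₀ := by
      field_simp
      ring
    rw [e]
    exact div_pos (mul_pos (by linarith) (by linarith)) h₀
  · have hg := busyMGF_lt h₀ hl hm hα
    have := hmgf α hα0.le (hα.le.trans hle) (by rwa [max_eq_left h.le])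
    rw [max_eq_left h.le] at this
    exact ⟨hg, this⟩
  · have hg : l₀ / m * busyMGF l m ((√m - √l) ^ 2) < 1 := by
      have e : l₀ / m * (√m / √l) = l₀ / (√l * √m) := by
        nth_rw 1 [← hb]
        field_simp
      rw [busyMGF_critical hl hm, e, div_lt_one (by positivity), ← hsq]
      exact hlt
    have := hmgf _ (sq_nonneg _) le_rfl (by rwa [max_eq_left h.le])
    rw [max_eq_left h.le] at this
    exact ⟨hg, this⟩
  · refine hd t ht _ (by positivity) fun f hf => ?_
    have hS := lintegral_busySurvival_critical_le ha0 hab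
    rw [ha, hb, ← hsq, ← heq] at hS
    have hS' : ∀ n, ∫⁻ x, busySurvival l m n x ∂(queueEq (max l₀ l) m) ≤
        ENNReal.ofReal (1 * (2 * √l * √m / (l + m)) ^ n) := fun n => by
      rw [max_eq_left h.le]
      exact hS n
    have := lintegral_queueLaw_le_add h₀ hl h₀m hlm zero_le_one (by positivity) ht hS' hf
    have e : -((1 - 2 * √l * √m / (l + m)) * ((l + m) * t)) = -(√m - √l) ^ 2 * t := by
      have e1 : (1 - 2 * √l * √m / (l + m)) * ((l + m) * t) = (l + m - 2 * √l * √m) * t := by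
        field_simp
      rw [e1]
      linear_combination t * ha + t * hb
    rwa [e] at this

/-! ### Exponential clocks -/

instance sFinite_expMeasure (r : ℝ) : SFinite (expMeasure r) := by
  unfold expMeasure gammaMeasure
  infer_instance

lemma lintegral_expMeasure (r : ℝ) {f : ℝ → ℝ≥0∞} (hf : Measurable f) :
    ∫⁻ x, f x ∂(expMeasure r) = ∫⁻ x in Ioi 0, ENNReal.ofReal (r * exp (-(r * x))) * f x := by
  have h : expMeasure r = volume.withDensity (exponentialPDF r) := rfl
  have hm : Measurable (exponentialPDF r) :=
    ENNReal.measurable_ofReal.comp (measurable_exponentialPDFReal r)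
  rw [h, lintegral_withDensity_eq_lintegral_mul _ hm hf,
    setLIntegral_congr Ioi_ae_eq_Ici, ← lintegral_indicator measurableSet_Ici]
  refine lintegral_congr fun x => ?_
  rw [Pi.mul_apply, exponentialPDF_eq, indicator_apply]
  by_cases hx : 0 ≤ x
  · simp [hx]
  · simp [hx]

lemma ae_expMeasure_pos (r : ℝ) : ∀ᵐ x ∂(expMeasure r), 0 < x := by
  have h : ∫⁻ x, (Iic (0 : ℝ)).indicator 1 x ∂(expMeasure r) = 0 := by
    rw [lintegral_expMeasure r (measurable_one.indicator measurableSet_Iic)]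
    refine (setLIntegral_congr_fun measurableSet_Ioi fun x hx => ?_).trans lintegral_zero
    rw [indicator_of_notMem (by simpa using hx), mul_zero]
  rw [lintegral_indicator_one measurableSet_Iic] at h
  rw [ae_iff]
  simpa [Iic] using h

/-- Memorylessness of the exponential distribution. -/
lemma setLIntegral_Ioi_expMeasure (r : ℝ) {s : ℝ} (hs : 0 ≤ s) {f : ℝ → ℝ≥0∞}
    (hf : Measurable f) :
    ∫⁻ v in Ioi s, f v ∂(expMeasure r) =
      ENNReal.ofReal (exp (-(r * s))) * ∫⁻ v, f (s + v) ∂(expMeasure r) := by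
  rw [← lintegral_indicator measurableSet_Ioi,
    lintegral_expMeasure r (hf.indicator measurableSet_Ioi),
    lintegral_expMeasure r (by fun_prop), ← lintegral_const_mul _ (by fun_prop),
    ← lintegral_indicator measurableSet_Ioi, ← lintegral_indicator measurableSet_Ioi,
    ← lintegral_add_left_eq_self (μ := volume) _ s]
  refine lintegral_congr fun x => ?_
  by_cases hx : 0 < x
  · have hsx : 0 < s + x := by linarith
    rw [indicator_of_mem (mem_Ioi.2 hsx), indicator_of_mem (mem_Ioi.2 (by linarith : s < s + x)),
      indicator_of_mem (mem_Ioi.2 hx), ← mul_assoc, ← ENNReal.ofReal_mul (exp_pos _).le,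
      mul_left_comm, ← exp_add]
    congr 4
    ring
  · rw [indicator_of_notMem (s := Ioi 0) (a := x) (by simpa using hx), indicator_apply,
      indicator_of_notMem (s := Ioi s) (by simpa using hx), mul_zero, ite_self]

lemma lintegral_expMeasure_exp_mul {l m : ℝ} (hl : 0 < l) (hm : 0 < m) {g : ℝ → ℝ≥0∞}
    (hg : Measurable g) :
    ∫⁻ a, ENNReal.ofReal (exp (-(m * a))) * g a ∂(expMeasure l) =
      ENNReal.ofReal (l / (l + m)) * ∫⁻ a, g a ∂(expMeasure (l + m)) := by
  rw [lintegral_expMeasure l (by fun_prop), lintegral_expMeasure (l + m) hg,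
    ← lintegral_const_mul _ (by fun_prop)]
  refine lintegral_congr fun x => ?_
  rw [← mul_assoc, ← mul_assoc, ← ENNReal.ofReal_mul (by positivity),
    ← ENNReal.ofReal_mul (by positivity), mul_assoc l, ← exp_add]
  congr 2
  have : -(l * x) + -(m * x) = -((l + m) * x) := by ring
  rw [this]
  field_simp

/-- The first of two independent exponential clocks rings after an exponential time with the sum of
the rates, and it is the first clock with probability `l / (l + m)`. -/
lemma lintegral_clock_first {l m : ℝ} (hl : 0 < l) (hm : 0 < m) {f : ℝ → ℝ → ℝ≥0∞}
    (hf : Measurable (Function.uncurry f)) :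
    ∫⁻ a, ∫⁻ v in Ioi a, f a v ∂(expMeasure m) ∂(expMeasure l) =
      ENNReal.ofReal (l / (l + m)) *
        ∫⁻ s, ∫⁻ v, f s (s + v) ∂(expMeasure m) ∂(expMeasure (l + m)) := by
  have h : Measurable fun s : ℝ => ∫⁻ v, f s (s + v) ∂(expMeasure m) := by
    refine Measurable.lintegral_prod_right' (f := fun p : ℝ × ℝ => f p.1 (p.1 + p.2)) ?_
    exact hf.comp (measurable_fst.prodMk (measurable_fst.add measurable_snd))
  rw [← lintegral_expMeasure_exp_mul hl hm h]
  refine lintegral_congr_ae ((ae_expMeasure_pos l).mono fun a ha => ?_)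
  exact setLIntegral_Ioi_expMeasure m ha.le (hf.comp (measurable_const.prodMk measurable_id))

lemma two_clocks_le {l m : ℝ} (hl : 0 < l) (hm : 0 < m) {f : ℝ → ℝ → ℝ≥0∞}
    (hf : Measurable (Function.uncurry f)) :
    ENNReal.ofReal (l / (l + m)) *
        ∫⁻ s, ∫⁻ v, f s (s + v) ∂(expMeasure m) ∂(expMeasure (l + m)) +
      ENNReal.ofReal (m / (l + m)) *
        ∫⁻ s, ∫⁻ a, f (s + a) s ∂(expMeasure l) ∂(expMeasure (l + m)) ≤
      ∫⁻ a, ∫⁻ v, f a v ∂(expMeasure m) ∂(expMeasure l) := by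
  have hswap : Measurable (Function.uncurry fun v a => f a v) := hf.comp measurable_swap
  have h2 := lintegral_clock_first hm hl hswap
  rw [add_comm m l] at h2
  rw [← lintegral_clock_first hl hm hf, ← h2]
  have hlt : MeasurableSet {p : ℝ × ℝ | p.1 < p.2} := measurableSet_lt measurable_fst measurable_snd
  have hgt : MeasurableSet {p : ℝ × ℝ | p.2 < p.1} := measurableSet_lt measurable_snd measurable_fst
  have hm1 := hf.indicator hlt
  have hm2 := hf.indicator hgt
  have e1 : ∀ a, ∫⁻ v in Ioi a, f a v ∂(expMeasure m) =
      ∫⁻ v, {p : ℝ × ℝ | p.1 < p.2}.indicator (Function.uncurry f) (a, v) ∂(expMeasure m) :=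
    fun a => by
      rw [← lintegral_indicator measurableSet_Ioi]
      rfl
  have e2 : ∀ v, ∫⁻ a in Ioi v, f a v ∂(expMeasure l) =
      ∫⁻ a, {p : ℝ × ℝ | p.2 < p.1}.indicator (Function.uncurry f) (a, v) ∂(expMeasure l) :=
    fun a => by
      rw [← lintegral_indicator measurableSet_Ioi]
      rfl
  simp_rw [e1, e2]
  rw [lintegral_lintegral_swap (f := fun v a =>
      {p : ℝ × ℝ | p.2 < p.1}.indicator (Function.uncurry f) (a, v))
      (hm2.comp measurable_swap).aemeasurable,
    ← lintegral_add_left hm1.lintegral_prod_right']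
  refine lintegral_mono fun a => ?_
  dsimp only
  rw [← lintegral_add_left (f := fun v =>
    {p : ℝ × ℝ | p.1 < p.2}.indicator (Function.uncurry f) (a, v))
    (hm1.comp measurable_prodMk_left)]
  refine lintegral_mono fun v => ?_
  simp only [indicator_apply, mem_ofPred_eq, Function.uncurry_apply_pair]
  split_ifs with h h'
  · exact absurd h (lt_asymm h')
  all_goals simp

/-- The competition of two exponential clocks, stopped at time `t`. -/
lemma two_clocks_until_le {l m : ℝ} (hl : 0 < l) (hm : 0 < m) {f : ℝ → ℝ → ℝ≥0∞}
    (hf : Measurable (Function.uncurry f)) {t : ℝ} (ht : 0 ≤ t) :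
    ENNReal.ofReal (exp (-((l + m) * t))) *
        ∫⁻ a, ∫⁻ v, f (t + a) (t + v) ∂(expMeasure m) ∂(expMeasure l) +
      ∫⁻ s in Iic t, (ENNReal.ofReal (l / (l + m)) * ∫⁻ v, f s (s + v) ∂(expMeasure m) +
        ENNReal.ofReal (m / (l + m)) * ∫⁻ a, f (s + a) s ∂(expMeasure l)) ∂(expMeasure (l + m)) ≤
      ∫⁻ a, ∫⁻ v, f a v ∂(expMeasure m) ∂(expMeasure l) := by
  set E : Set (ℝ × ℝ) := {p | p.1 ≤ t ∨ p.2 ≤ t} with hE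
  have hEm : MeasurableSet E := (measurableSet_le measurable_fst measurable_const).union
    (measurableSet_le measurable_snd measurable_const)
  have h1 := hf.indicator hEm
  have h2 := hf.indicator hEm.compl
  have hsplit : ∫⁻ a, ∫⁻ v, f a v ∂(expMeasure m) ∂(expMeasure l) =
      ∫⁻ a, ∫⁻ v, Eᶜ.indicator (Function.uncurry f) (a, v) ∂(expMeasure m) ∂(expMeasure l) +
      ∫⁻ a, ∫⁻ v, E.indicator (Function.uncurry f) (a, v) ∂(expMeasure m) ∂(expMeasure l) := by
    rw [← lintegral_add_left h2.lintegral_prod_right']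
    refine lintegral_congr fun a => ?_
    rw [← lintegral_add_left (f := fun v => Eᶜ.indicator (Function.uncurry f) (a, v))
      (h2.comp measurable_prodMk_left)]
    refine lintegral_congr fun v => ?_
    simp only [indicator_apply, mem_compl_iff, Function.uncurry_apply_pair]
    split_ifs <;> simp
  have hma : Measurable fun s : ℝ => ∫⁻ v, f s (s + v) ∂(expMeasure m) :=
    (hf.comp (measurable_fst.prodMk (measurable_fst.add measurable_snd))).lintegral_prod_right'
  have hma' : Measurable fun s : ℝ => ∫⁻ a, f (s + a) s ∂(expMeasure l) :=
    (hf.comp ((measurable_fst.add measurable_snd).prodMk measurable_fst)).lintegral_prod_right'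
  rw [hsplit]
  refine add_le_add (le_of_eq ?_) (le_trans ?_
    (two_clocks_le hl hm (f := fun a v => E.indicator (Function.uncurry f) (a, v)) h1))
  · have e : ∀ a v, Eᶜ.indicator (Function.uncurry f) (a, v) =
        (Ioi t).indicator (fun a => (Ioi t).indicator (fun v => f a v) v) a := by
      intro a v
      simp only [indicator_apply, mem_compl_iff, hE, mem_ofPred_eq, mem_Ioi, not_or, not_le,
        Function.uncurry_apply_pair]
      split_ifs <;> simp_all
    have e' : ∀ a, ∫⁻ v, Eᶜ.indicator (Function.uncurry f) (a, v) ∂(expMeasure m) =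
        (Ioi t).indicator (fun a => ENNReal.ofReal (exp (-(m * t))) *
          ∫⁻ v, f a (t + v) ∂(expMeasure m)) a := by
      intro a
      simp_rw [e]
      by_cases ha : a ∈ Ioi t
      · simp_rw [indicator_of_mem ha]
        rw [lintegral_indicator measurableSet_Ioi, setLIntegral_Ioi_expMeasure m ht
          (f := fun v => f a v) (hf.comp measurable_prodMk_left)]
      · simp_rw [indicator_of_notMem ha]
        simp
    have hmb : Measurable fun a : ℝ => ∫⁻ v, f a (t + v) ∂(expMeasure m) :=
      (hf.comp (measurable_fst.prodMk (measurable_snd.const_add t))).lintegral_prod_right'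
    simp_rw [e']
    rw [lintegral_indicator measurableSet_Ioi, setLIntegral_Ioi_expMeasure l ht (by fun_prop),
      lintegral_const_mul _ (by fun_prop), ← mul_assoc, ← ENNReal.ofReal_mul (exp_pos _).le,
      ← exp_add]
    congr 3
    ring
  · rw [lintegral_add_left (by fun_prop), lintegral_const_mul _ (by fun_prop),
      lintegral_const_mul _ (by fun_prop)]
    refine add_le_add (mul_le_mul_right ?_ _) (mul_le_mul_right ?_ _)
    all_goals
      rw [← lintegral_indicator measurableSet_Iic]
      refine lintegral_mono fun s => ?_
      by_cases hs : s ∈ Iic t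
      · rw [indicator_of_mem hs]
        refine lintegral_mono fun v => ?_
        rw [indicator_of_mem (by simp only [hE, mem_ofPred_eq]; tauto)]
        rfl
      · rw [indicator_of_notMem hs]
        exact zero_le

lemma map_div_expMeasure_one {r : ℝ} (hr : 0 < r) :
    (expMeasure 1).map (fun x => x / r) = expMeasure r := by
  have := isProbabilityMeasure_expMeasure hr
  have h' : IsProbabilityMeasure ((expMeasure 1).map fun x => x / r) :=
    Measure.isProbabilityMeasure_map (by fun_prop)
  refine Measure.eq_of_cdf _ _ ?_
  ext x
  rw [cdf_expMeasure_eq hr, cdf_eq_real, map_measureReal_apply (by fun_prop) measurableSet_Iic]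
  have : (fun x => x / r) ⁻¹' Iic x = Iic (r * x) := by
    ext y
    simp [div_le_iff₀ hr, mul_comm]
  rw [this, ← cdf_eq_real, cdf_expMeasure_eq one_pos, one_mul]
  simp only [mul_nonneg_iff_of_pos_left hr]

/-! ### Sums of service times -/

/-- The Erlang law: the law of the sum of `x` independent exponential service times of rate `m`. -/
def erlang (m : ℝ) : ℕ → Measure ℝ
  | 0 => Measure.dirac 0
  | x + 1 => (erlang m x) ∗ (expMeasure m)

lemma isProbabilityMeasure_erlang {m : ℝ} (hm : 0 < m) (x : ℕ) :
    IsProbabilityMeasure (erlang m x) := by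
  have := isProbabilityMeasure_expMeasure hm
  induction x with
  | zero => exact Measure.dirac.isProbabilityMeasure
  | succ x ih =>
    rw [erlang]
    infer_instance

lemma lintegral_erlang_succ (m : ℝ) (x : ℕ) {f : ℝ → ℝ≥0∞} (hf : Measurable f) :
    ∫⁻ w, f w ∂(erlang m (x + 1)) = ∫⁻ w, ∫⁻ v, f (w + v) ∂(expMeasure m) ∂(erlang m x) := by
  rw [erlang, Measure.lintegral_conv hf]

lemma ae_erlang_nonneg {m : ℝ} (x : ℕ) : ∀ᵐ w ∂(erlang m x), 0 ≤ w := by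
  induction x with
  | zero =>
    rw [erlang, ae_dirac_iff measurableSet_Ici]
  | succ x ih =>
    have h := lintegral_erlang_succ m x
      ((measurable_one : Measurable (1 : ℝ → ℝ≥0∞)).indicator measurableSet_Iio)
      (f := (Iio (0 : ℝ)).indicator 1)
    have h0 : ∫⁻ w, ∫⁻ v, (Iio (0 : ℝ)).indicator 1 (w + v) ∂(expMeasure m) ∂(erlang m x) =
        (0 : ℝ≥0∞) := by
      rw [← lintegral_zero (μ := erlang m x)]
      refine lintegral_congr_ae (ih.mono fun w hw => ?_)
      dsimp only
      rw [← lintegral_zero (μ := expMeasure m)]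
      refine lintegral_congr_ae ((ae_expMeasure_pos m).mono fun v hv => ?_)
      exact indicator_of_notMem (by rw [mem_Iio, not_lt]; linarith) _
    rw [h0, lintegral_indicator_one measurableSet_Iio] at h
    rw [ae_iff]
    simpa [Iio] using h

/-- A geometric number of exponential service times: the workload of a stationary queue. The
workload law satisfies the corresponding renewal inequality because an exponential clock of rate
`m - l` rings first against one of rate `l` with probability `1 - l / m`. -/
lemma bind_erlang_queueEq {l m : ℝ} (hl : 0 < l) (hlm : l < m) :
    (queueEq l m).bind (erlang m) = workloadEq l m := by
  have hm : 0 < m := hl.trans hlm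
  have hd : 0 < m - l := by linarith
  have hr : 0 < 1 - l / m := sub_pos.2 ((div_lt_one hm).2 hlm)
  have := isProbabilityMeasure_expMeasure hm
  have := isProbabilityMeasure_expMeasure hd
  have := isProbabilityMeasure_queueEq hl hlm
  have := isProbabilityMeasure_erlang hm
  have hW : IsProbabilityMeasure (workloadEq l m) := ⟨by
    simp only [workloadEq, Measure.add_apply, Measure.smul_apply, measure_univ, smul_eq_mul,
      mul_one]
    rw [← ENNReal.ofReal_add hr.le (by positivity), sub_add_cancel, ENNReal.ofReal_one]⟩
  have hint : ∀ h : ℝ → ℝ≥0∞, Measurable h → ∫⁻ w, h w ∂(workloadEq l m) =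
      ENNReal.ofReal (1 - l / m) * h 0 +
        ENNReal.ofReal (l / m) * ∫⁻ w, h w ∂(expMeasure (m - l)) := fun h hh => by
    rw [workloadEq, lintegral_add_measure, lintegral_smul_measure, lintegral_smul_measure,
      lintegral_dirac' _ hh]
    rfl
  have hrenew : ∀ h : ℝ → ℝ≥0∞, Measurable h → ENNReal.ofReal (1 - l / m) * h 0 +
      ENNReal.ofReal (l / m) * ∫⁻ w, ∫⁻ v, h (w + v) ∂(expMeasure m) ∂(workloadEq l m) ≤
        ∫⁻ w, h w ∂(workloadEq l m) := by
    intro h hh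
    -- clocks of rates `m - l` and `l` compete, and `h` depends only on the time of the former
    have h2 := two_clocks_le hd hl (f := fun a _ => h a) (hh.comp measurable_fst)
    have := isProbabilityMeasure_expMeasure hl
    simp only [sub_add_cancel, lintegral_const, measure_univ, mul_one] at h2
    have e1 : (m - l) / m = 1 - l / m := by field_simp
    rw [e1] at h2
    have hv : Measurable fun w : ℝ => ∫⁻ v, h (w + v) ∂(expMeasure m) :=
      (hh.comp (measurable_fst.add measurable_snd)).lintegral_prod_right'
    rw [hint _ hv, hint h hh]
    refine add_le_add le_rfl (mul_le_mul_right (le_trans (le_of_eq ?_) h2) _)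
    rw [lintegral_lintegral_swap (f := fun w v => h (w + v))
      (hh.comp (measurable_fst.add measurable_snd)).aemeasurable]
    simp [add_comm]
  have hpart : ∀ (n : ℕ) (h : ℝ → ℝ≥0∞), Measurable h →
      ∑ k ∈ Finset.range n, ENNReal.ofReal ((1 - l / m) * (l / m) ^ k) * ∫⁻ w, h w ∂(erlang m k) ≤
        ∫⁻ w, h w ∂(workloadEq l m) := by
    intro n
    induction n with
    | zero => simp
    | succ n ih =>
      intro h hh
      have hv : Measurable fun w : ℝ => ∫⁻ v, h (w + v) ∂(expMeasure m) :=
        (hh.comp (measurable_fst.add measurable_snd)).lintegral_prod_right'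
      refine le_trans ?_ (hrenew h hh)
      rw [Finset.sum_range_succ', add_comm]
      refine add_le_add ?_ ((le_of_eq ?_).trans (mul_le_mul_right (ih _ hv) _))
      · simp [erlang, lintegral_dirac' _ hh]
      · rw [Finset.mul_sum]
        refine Finset.sum_congr rfl fun k _ => ?_
        rw [lintegral_erlang_succ m k hh, ← mul_assoc, ← ENNReal.ofReal_mul (by positivity),
          pow_succ]
        congr 2
        ring
  have hB : IsProbabilityMeasure ((queueEq l m).bind (erlang m)) := ⟨by
    rw [Measure.bind_apply MeasurableSet.univ (by fun_prop)]
    simp⟩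
  refine Measure.eq_of_le_of_isProbabilityMeasure (Measure.le_iff.2 fun s hs => ?_)
  rw [Measure.bind_apply hs (by fun_prop), lintegral_queueEq, ENNReal.tsum_eq_iSup_nat]
  refine iSup_le fun n => ?_
  have := hpart n (s.indicator 1) (measurable_one.indicator hs)
  simpa only [lintegral_indicator_one hs] using this

/-! ### The first arrival -/

/-- The driving sequence with first entry `p`, followed by `ω`. -/
def driveCons (p : ℝ × ℝ) (ω : Drive) : Drive
  | 0 => p
  | n + 1 => ω n

lemma measurable_driveCons :
    Measurable fun q : (ℝ × ℝ) × Drive => driveCons q.1 q.2 := by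
  refine measurable_pi_iff.2 fun n => ?_
  rcases n with _ | n
  · exact measurable_fst
  · exact (measurable_pi_apply n).comp measurable_snd

instance isProbabilityMeasure_driveLaw : IsProbabilityMeasure driveLaw := by
  unfold driveLaw
  infer_instance

lemma map_driveCons_driveLaw :
    (((expMeasure 1).prod (expMeasure 1)).prod driveLaw).map
      (fun q : (ℝ × ℝ) × Drive => driveCons q.1 q.2) = driveLaw := by
  classical
  refine Measure.eq_infinitePi _ fun s T hT => ?_
  obtain ⟨N, hN⟩ : ∃ N, s ⊆ Finset.range N := s.exists_nat_subset_range
  set T' : ℕ → Set (ℝ × ℝ) := fun i => if i ∈ s then T i else univ with hT'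
  have hT'm : ∀ i, MeasurableSet (T' i) := fun i => by
    simp only [hT']
    split_ifs
    exacts [hT i, MeasurableSet.univ]
  have hpre : (fun q : (ℝ × ℝ) × Drive => driveCons q.1 q.2) ⁻¹' (Set.pi s T) =
      T' 0 ×ˢ Set.pi (Finset.range N) fun i => T' (i + 1) := by
    ext ⟨p, ω⟩
    simp only [mem_preimage, Set.mem_pi, Finset.mem_coe, mem_prod, Finset.mem_range, hT']
    constructor
    · intro h
      refine ⟨?_, fun i _ => ?_⟩
      · split_ifs with h0
        · exact h 0 h0
        · trivial
      · split_ifs with h0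
        · exact h (i + 1) h0
        · trivial
    · rintro ⟨h0, h1⟩ i hi
      rcases i with _ | i
      · rw [if_pos hi] at h0
        exact h0
      · have := h1 i (by have := Finset.mem_range.1 (hN hi); omega)
        rw [if_pos hi] at this
        exact this
  rw [Measure.map_apply measurable_driveCons (.pi s.countable_toSet fun i _ => hT i), hpre,
    Measure.prod_prod, driveLaw, Measure.infinitePi_pi _ fun i _ => hT'm (i + 1), mul_comm,
    ← Finset.prod_range_succ' fun i => ((expMeasure 1).prod (expMeasure 1)) (T' i)]
  have hsub : s ⊆ Finset.range (N + 1) :=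
    hN.trans (Finset.range_subset_range.2 (Nat.le_succ N))
  rw [← Finset.prod_subset hsub fun i _ hi => by simp [hT', hi]]
  exact Finset.prod_congr rfl fun i hi => by simp [hT', hi]

lemma lintegral_driveLaw {G : Drive → ℝ≥0∞} (hG : Measurable G) :
    ∫⁻ ω, G ω ∂driveLaw =
      ∫⁻ p, ∫⁻ ω, G (driveCons p ω) ∂driveLaw ∂((expMeasure 1).prod (expMeasure 1)) := by
  conv_lhs => rw [← map_driveCons_driveLaw]
  rw [lintegral_map hG measurable_driveCons, lintegral_prod
    (fun q : (ℝ × ℝ) × Drive => G (driveCons q.1 q.2))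
    (hG.comp measurable_driveCons).aemeasurable]

lemma ae_driveLaw_nonneg : ∀ᵐ ω ∂driveLaw, ∀ i, 0 ≤ (ω i).1 := by
  rw [ae_all_iff]
  intro i
  have h1 : ∀ᵐ p ∂((expMeasure 1).prod (expMeasure 1)), 0 ≤ p.1 := by
    have h := Measure.quasiMeasurePreserving_fst (μ := expMeasure 1) (ν := expMeasure 1)
    exact h.ae ((ae_expMeasure_pos 1).mono fun x hx => hx.le)
  have h2 : MeasurePreserving (Function.eval i) driveLaw ((expMeasure 1).prod (expMeasure 1)) :=
    measurePreserving_eval_infinitePi _ i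
  exact h2.quasiMeasurePreserving.ae h1

lemma arrivalTime_driveCons (l : ℝ) (p : ℝ × ℝ) (ω : Drive) (n : ℕ) :
    arrivalTime l (driveCons p ω) (n + 1) = p.1 / l + arrivalTime l ω n := by
  rw [arrivalTime, Finset.sum_range_succ', add_comm]
  rfl

lemma workloadAfter_driveCons (l m w : ℝ) (p : ℝ × ℝ) (ω : Drive) (n : ℕ) :
    workloadAfter l m w (driveCons p ω) (n + 1) =
      workloadAfter l m (max (w - p.1 / l) 0 + p.2 / m) ω n := by
  induction n with
  | zero => rfl
  | succ n ih =>
    rw [workloadAfter, ih]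
    rfl

/-- The value of `F` at the workload at time `t` if exactly `n` customers have arrived by then, and
`0` otherwise. -/
def workloadOn (l m : ℝ) (F : ℝ → ℝ≥0∞) (n : ℕ) (t w : ℝ) (ω : Drive) : ℝ≥0∞ :=
  open Classical in
  if (∀ i, 0 ≤ (ω i).1) ∧ arrivalTime l ω n ≤ t ∧ t < arrivalTime l ω (n + 1) then
    F (max (workloadAfter l m w ω n - (t - arrivalTime l ω n)) 0) else 0

lemma arrivalTime_mono {l : ℝ} (hl : 0 < l) {ω : Drive} (hω : ∀ i, 0 ≤ (ω i).1) :
    Monotone (arrivalTime l ω) := by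
  refine monotone_nat_of_le_succ fun n => ?_
  rw [arrivalTime, arrivalTime, Finset.sum_range_succ]
  exact le_add_of_nonneg_right (div_nonneg (hω n) hl.le)

lemma arrivalTime_nonneg {l : ℝ} (hl : 0 < l) {ω : Drive} (hω : ∀ i, 0 ≤ (ω i).1) (n : ℕ) :
    0 ≤ arrivalTime l ω n :=
  arrivalTime_mono hl hω (Nat.zero_le n)

lemma tsum_workloadOn_le {l m : ℝ} (hl : 0 < l) (F : ℝ → ℝ≥0∞) (t w : ℝ) (ω : Drive) :
    ∑' n, workloadOn l m F n t w ω ≤ F (workload l m w t ω) := by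
  by_cases h : ∃ n, (∀ i, 0 ≤ (ω i).1) ∧ arrivalTime l ω n ≤ t ∧ t < arrivalTime l ω (n + 1)
  · obtain ⟨n, hω, h1, h2⟩ := h
    have hmono := arrivalTime_mono hl hω
    have hk : ∀ k, arrivalTime l ω k ≤ t → k ≤ n := fun k hk => by
      by_contra hc
      exact absurd (hmono (not_le.1 hc : n + 1 ≤ k)) (by linarith)
    have hN : arrivalCount l t ω = n := IsGreatest.csSup_eq ⟨h1, fun k hk' => hk k hk'⟩
    rw [tsum_eq_single n]
    · rw [workloadOn, if_pos ⟨hω, h1, h2⟩, workload, hN]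
    · intro k hkn
      rw [workloadOn, if_neg]
      rintro ⟨-, h3, h4⟩
      have := hmono (Nat.succ_le_of_lt ((hk k h3).lt_of_ne hkn))
      linarith
  · have : ∀ n, workloadOn l m F n t w ω = 0 := fun n => if_neg fun hn => h ⟨n, hn⟩
    simp [this]

lemma measurable_workloadOn (l m : ℝ) {F : ℝ → ℝ≥0∞} (hF : Measurable F) (n : ℕ) :
    Measurable fun p : (ℝ × ℝ) × Drive => workloadOn l m F n p.1.1 p.1.2 p.2 := by
  have hA : ∀ n, Measurable fun p : (ℝ × ℝ) × Drive => arrivalTime l p.2 n := fun n =>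
    (measurable_arrivalTime l n).comp measurable_snd
  have ht : Measurable fun p : (ℝ × ℝ) × Drive => p.1.1 := measurable_fst.fst
  have hW : Measurable fun p : (ℝ × ℝ) × Drive => workloadAfter l m p.1.2 p.2 n :=
    (measurable_workloadAfter l m n).comp (measurable_fst.snd.prodMk measurable_snd)
  have h0 : MeasurableSet {p : (ℝ × ℝ) × Drive | ∀ i, 0 ≤ (p.2 i).1} := by
    rw [ofPred_forall]
    exact MeasurableSet.iInter fun i => measurableSet_le measurable_const
      ((measurable_pi_apply i).comp measurable_snd).fst
  refine Measurable.ite ?_ (hF.comp ((hW.sub (ht.sub (hA n))).max measurable_const))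
    measurable_const
  exact h0.inter ((measurableSet_le (hA n) ht).inter (measurableSet_lt ht (hA (n + 1))))

/-- The mean of `F` at the workload at time `t`, from the initial workload `w`, on the event (of
probability one) that only finitely many customers arrive up to time `t`. -/
def workloadOp (l m : ℝ) (F : ℝ → ℝ≥0∞) (t w : ℝ) : ℝ≥0∞ :=
  ∫⁻ ω, ∑' n, workloadOn l m F n t w ω ∂driveLaw

lemma measurable_tsum_workloadOn (l m : ℝ) {F : ℝ → ℝ≥0∞} (hF : Measurable F) :
    Measurable fun p : (ℝ × ℝ) × Drive => ∑' n, workloadOn l m F n p.1.1 p.1.2 p.2 :=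
  Measurable.tsum fun n => measurable_workloadOn l m hF n

lemma measurable_workloadOp (l m : ℝ) {F : ℝ → ℝ≥0∞} (hF : Measurable F) :
    Measurable fun p : ℝ × ℝ => workloadOp l m F p.1 p.2 :=
  (measurable_tsum_workloadOn l m hF).lintegral_prod_right'

/-- The mean of `F` at the workload at time `t`, from the initial workload `w`, given that the first
customer arrives at time `a`. -/
def workloadGiven (l m : ℝ) (F : ℝ → ℝ≥0∞) (t w a : ℝ) : ℝ≥0∞ :=
  if t < a then F (max (w - t) 0)
  else ∫⁻ b, workloadOp l m F (t - a) (max (w - a) 0 + b) ∂(expMeasure m)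

lemma measurable_workloadGiven (l m : ℝ) {F : ℝ → ℝ≥0∞} (hF : Measurable F) (t : ℝ) :
    Measurable fun p : ℝ × ℝ => workloadGiven l m F t p.1 p.2 := by
  refine Measurable.ite (measurableSet_lt measurable_const measurable_snd) (by fun_prop) ?_
  refine Measurable.lintegral_prod_right' (f := fun q : (ℝ × ℝ) × ℝ =>
    workloadOp l m F (t - q.1.2) (max (q.1.1 - q.1.2) 0 + q.2)) ?_
  exact (measurable_workloadOp l m hF).comp (by fun_prop :
    Measurable fun q : (ℝ × ℝ) × ℝ => (t - q.1.2, max (q.1.1 - q.1.2) 0 + q.2))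

lemma tsum_workloadOn_driveCons_of_lt {l m : ℝ} (hl : 0 < l) (F : ℝ → ℝ≥0∞) {t : ℝ} (ht : 0 ≤ t)
    (w : ℝ) {p : ℝ × ℝ} (hp : t < p.1 / l) {ω : Drive} (hω : ∀ i, 0 ≤ (ω i).1) :
    ∑' n, workloadOn l m F n t w (driveCons p ω) = F (max (w - t) 0) := by
  have hp0 : 0 ≤ p.1 := by
    have : 0 < p.1 / l := ht.trans_lt hp
    exact ((div_pos_iff_of_pos_right hl).1 this).le
  have hcons : ∀ i, 0 ≤ (driveCons p ω i).1 := fun i => by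
    rcases i with _ | i
    exacts [hp0, hω i]
  have h1 : arrivalTime l (driveCons p ω) 0 = 0 := by simp [arrivalTime]
  have h2 : arrivalTime l (driveCons p ω) (0 + 1) = p.1 / l := by
    rw [arrivalTime_driveCons]
    simp [arrivalTime]
  rw [tsum_eq_single 0]
  · rw [workloadOn, if_pos ⟨hcons, by rw [h1]; exact ht, by rw [h2]; exact hp⟩, h1, sub_zero]
    rfl
  · intro n hn
    obtain ⟨k, rfl⟩ := Nat.exists_eq_succ_of_ne_zero hn
    rw [workloadOn, if_neg]
    rintro ⟨-, h3, -⟩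
    rw [Nat.succ_eq_add_one, arrivalTime_driveCons] at h3
    have := arrivalTime_nonneg hl hω k
    linarith

lemma tsum_workloadOn_driveCons_of_le {l m : ℝ} (F : ℝ → ℝ≥0∞) {t : ℝ}
    (w : ℝ) {p : ℝ × ℝ} (hp0 : 0 ≤ p.1) (hp : p.1 / l ≤ t) (ω : Drive) :
    ∑' n, workloadOn l m F n t w (driveCons p ω) =
      ∑' n, workloadOn l m F n (t - p.1 / l) (max (w - p.1 / l) 0 + p.2 / m) ω := by
  have hcons : (∀ i, 0 ≤ (driveCons p ω i).1) ↔ ∀ i, 0 ≤ (ω i).1 := by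
    refine ⟨fun h i => h (i + 1), fun h i => ?_⟩
    rcases i with _ | i
    exacts [hp0, h i]
  have h0 : workloadOn l m F 0 t w (driveCons p ω) = 0 := by
    rw [workloadOn, if_neg]
    rintro ⟨-, -, h⟩
    rw [arrivalTime_driveCons] at h
    simp only [arrivalTime, Finset.range_zero, Finset.sum_empty, add_zero] at h
    linarith
  rw [tsum_eq_zero_add' ENNReal.summable, h0, zero_add]
  refine tsum_congr fun n => ?_
  rw [workloadOn, workloadOn, arrivalTime_driveCons, arrivalTime_driveCons, workloadAfter_driveCons,
    sub_sub]
  have e1 : p.1 / l + arrivalTime l ω n ≤ t ↔ arrivalTime l ω n ≤ t - p.1 / l := by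
    constructor <;> intro h <;> linarith
  have e2 : t < p.1 / l + arrivalTime l ω (n + 1) ↔ t - p.1 / l < arrivalTime l ω (n + 1) := by
    constructor <;> intro h <;> linarith
  congr 1
  exact propext (hcons.and (e1.and e2))

/-- Decomposition at the first arrival. -/
lemma workloadOp_eq_lintegral {l m : ℝ} (hl : 0 < l) (hm : 0 < m) {F : ℝ → ℝ≥0∞}
    (hF : Measurable F) {t : ℝ} (ht : 0 ≤ t) (w : ℝ) :
    workloadOp l m F t w = ∫⁻ a, workloadGiven l m F t w a ∂(expMeasure l) := by
  have := isProbabilityMeasure_expMeasure hm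
  set g : ℝ → ℝ → ℝ≥0∞ := fun a b =>
    if t < a then F (max (w - t) 0) else workloadOp l m F (t - a) (max (w - a) 0 + b) with hg
  have hgm : Measurable (Function.uncurry g) := by
    refine Measurable.ite (measurableSet_lt measurable_const measurable_fst) (by fun_prop) ?_
    exact (measurable_workloadOp l m hF).comp (by fun_prop :
      Measurable fun q : ℝ × ℝ => (t - q.1, max (w - q.1) 0 + q.2))
  have hS : Measurable fun ω : Drive => ∑' n, workloadOn l m F n t w ω :=
    (measurable_tsum_workloadOn l m hF).comp (measurable_const.prodMk measurable_id :
      Measurable fun ω : Drive => ((t, w), ω))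
  have hpos : ∀ᵐ p ∂((expMeasure 1).prod (expMeasure 1)), 0 ≤ p.1 :=
    Measure.quasiMeasurePreserving_fst.ae ((ae_expMeasure_pos 1).mono fun x hx => hx.le)
  have h1 : workloadOp l m F t w =
      ∫⁻ p, g (p.1 / l) (p.2 / m) ∂((expMeasure 1).prod (expMeasure 1)) := by
    rw [workloadOp, lintegral_driveLaw hS]
    refine lintegral_congr_ae (hpos.mono fun p hp => ?_)
    simp only [hg]
    split_ifs with h
    · rw [lintegral_congr_ae (ae_driveLaw_nonneg.mono fun ω hω =>
        tsum_workloadOn_driveCons_of_lt hl F ht w h hω)]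
      simp
    · rw [workloadOp]
      exact lintegral_congr fun ω =>
        tsum_workloadOn_driveCons_of_le F w hp (not_lt.1 h) ω
  have h2 : ∫⁻ p, g (p.1 / l) (p.2 / m) ∂((expMeasure 1).prod (expMeasure 1)) =
      ∫⁻ a, ∫⁻ b, g a b ∂(expMeasure m) ∂(expMeasure l) := by
    rw [lintegral_prod (fun p : ℝ × ℝ => g (p.1 / l) (p.2 / m)) (hgm.comp (by fun_prop :
      Measurable fun p : ℝ × ℝ => (p.1 / l, p.2 / m))).aemeasurable, ← map_div_expMeasure_one hl,
      ← map_div_expMeasure_one hm,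
      lintegral_map (f := fun a => ∫⁻ b, g a b ∂((expMeasure 1).map fun x => x / m))
        hgm.lintegral_prod_right' (by fun_prop)]
    refine lintegral_congr fun a => ?_
    rw [lintegral_map (f := fun b => g (a / l) b) (hgm.comp measurable_prodMk_left) (by fun_prop)]
  rw [h1, h2]
  refine lintegral_congr fun a => ?_
  simp only [hg, workloadGiven]
  split_ifs <;> simp

/-! ### The first epoch of the workload -/

lemma measurable_lintegral_add (r : ℝ) {G : ℝ × ℝ → ℝ≥0∞} (hG : Measurable G) :
    Measurable fun p : ℝ × ℝ => ∫⁻ v, G (p.1, p.2 + v) ∂(expMeasure r) :=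
  Measurable.lintegral_prod_right' (f := fun q : (ℝ × ℝ) × ℝ => G (q.1.1, q.1.2 + q.2))
    (hG.comp (by fun_prop))

/-- Decomposition of the workload at the minimum of the first arrival time and of an exponential
service time `v`. The coefficient `ε` is `1` if the customer with service time `v` is present, in
front of a residual workload `w`, and `0` for a virtual service at an empty queue. -/
lemma workloadOp_renewal {l m : ℝ} (hl : 0 < l) (hm : 0 < m) {F : ℝ → ℝ≥0∞}
    (hF : Measurable F) {t : ℝ} (ht : 0 ≤ t) {ε w : ℝ} (h : ε = 1 ∧ 0 ≤ w ∨ ε = 0 ∧ w = 0) :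
    ENNReal.ofReal (exp (-((l + m) * t))) * ∫⁻ v, F (w + ε * v) ∂(expMeasure m) +
      ∫⁻ s in Iic t, (ENNReal.ofReal (l / (l + m)) *
          ∫⁻ v, ∫⁻ b, workloadOp l m F (t - s) (w + ε * v + b) ∂(expMeasure m) ∂(expMeasure m) +
        ENNReal.ofReal (m / (l + m)) * workloadOp l m F (t - s) w) ∂(expMeasure (l + m)) ≤
      ∫⁻ v, workloadOp l m F t (w + ε * v) ∂(expMeasure m) := by
  have := isProbabilityMeasure_expMeasure hl
  have := isProbabilityMeasure_expMeasure hm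
  set f : ℝ → ℝ → ℝ≥0∞ := fun a v => workloadGiven l m F t (w + ε * v) a with hf
  have hfm : Measurable (Function.uncurry f) :=
    (measurable_workloadGiven l m hF t).comp (by fun_prop :
      Measurable fun p : ℝ × ℝ => (w + ε * p.2, p.1))
  have hR : ∫⁻ v, workloadOp l m F t (w + ε * v) ∂(expMeasure m) =
      ∫⁻ a, ∫⁻ v, f a v ∂(expMeasure m) ∂(expMeasure l) := by
    rw [lintegral_lintegral_swap hfm.aemeasurable]
    exact lintegral_congr fun v => workloadOp_eq_lintegral hl hm hF ht _
  rw [hR]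
  refine le_trans (le_of_eq ?_) (two_clocks_until_le hl hm hfm ht)
  congr 1
  · congr 1
    have e : ∀ᵐ a ∂(expMeasure l), ∫⁻ v, f (t + a) (t + v) ∂(expMeasure m) =
        ∫⁻ v, F (w + ε * v) ∂(expMeasure m) := by
      refine (ae_expMeasure_pos l).mono fun a ha => ?_
      refine lintegral_congr_ae ((ae_expMeasure_pos m).mono fun v hv => ?_)
      simp only [hf, workloadGiven]
      rw [if_pos (by linarith)]
      congr 1
      rcases h with ⟨rfl, hw⟩ | ⟨rfl, rfl⟩
      · rw [max_eq_left (by linarith)]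
        ring
      · rw [max_eq_right (by linarith)]
        ring
    rw [lintegral_congr_ae e]
    simp
  · refine lintegral_congr_ae ?_
    filter_upwards [ae_restrict_mem measurableSet_Iic, ae_restrict_of_ae (ae_expMeasure_pos _)]
      with s hst hs
    rw [mem_Iic] at hst
    have e1 : ∫⁻ v, ∫⁻ b, workloadOp l m F (t - s) (w + ε * v + b) ∂(expMeasure m)
        ∂(expMeasure m) = ∫⁻ v, f s (s + v) ∂(expMeasure m) := by
      refine lintegral_congr_ae ((ae_expMeasure_pos m).mono fun v hv => ?_)
      simp only [hf, workloadGiven]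
      rw [if_neg (by linarith)]
      have : max (w + ε * (s + v) - s) 0 = w + ε * v := by
        rcases h with ⟨rfl, hw⟩ | ⟨rfl, rfl⟩
        · rw [max_eq_left (by linarith)]
          ring
        · rw [max_eq_right (by linarith)]
          ring
      rw [this]
    have e2 : workloadOp l m F (t - s) w = ∫⁻ a, f (s + a) s ∂(expMeasure l) := by
      rw [workloadOp_eq_lintegral hl hm hF (by linarith)]
      refine lintegral_congr_ae ((ae_expMeasure_pos l).mono fun a ha => ?_)
      simp only [hf, workloadGiven]
      have hmax : ∀ c, s ≤ c → max (w + ε * s - c) 0 = max (w - (c - s)) 0 := fun c hc => by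
        rcases h with ⟨rfl, hw⟩ | ⟨rfl, rfl⟩
        · congr 1
          ring
        · rw [max_eq_right (by linarith), max_eq_right (by linarith)]
      rw [hmax t hst, hmax (s + a) (by linarith), add_sub_cancel_left, sub_sub]
      have hiff : t - s < a ↔ t < s + a := by constructor <;> intro h <;> linarith
      simp only [hiff]
    rw [e1, e2]

/-- The mean of `F` at the workload at time `t` if initially `x` customers are present. -/
def erlangOp (l m : ℝ) (F : ℝ → ℝ≥0∞) (t : ℝ) (x : ℕ) : ℝ≥0∞ :=
  ∫⁻ w, workloadOp l m F t w ∂(erlang m x)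

lemma erlangOp_succ (l m : ℝ) {F : ℝ → ℝ≥0∞} (hF : Measurable F) (t : ℝ) (x : ℕ) :
    erlangOp l m F t (x + 1) =
      ∫⁻ w, ∫⁻ v, workloadOp l m F t (w + v) ∂(expMeasure m) ∂(erlang m x) :=
  lintegral_erlang_succ m x ((measurable_workloadOp l m hF).comp measurable_prodMk_left)

lemma erlangOp_renewal {l m : ℝ} (hl : 0 < l) (hm : 0 < m) {F : ℝ → ℝ≥0∞}
    (hF : Measurable F) {t : ℝ} (ht : 0 ≤ t) (x : ℕ) :
    ENNReal.ofReal (exp (-((l + m) * t))) * ∫⁻ w, F w ∂(erlang m x) +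
      ∫⁻ s in Iic t, queueOp l m (erlangOp l m F (t - s)) x ∂(expMeasure (l + m)) ≤
      erlangOp l m F t x := by
  have := isProbabilityMeasure_expMeasure hm
  have := isProbabilityMeasure_erlang hm
  have hΦ := measurable_workloadOp l m hF
  have hΦt : ∀ τ, Measurable fun w => workloadOp l m F τ w := fun τ =>
    hΦ.comp measurable_prodMk_left
  have hG1 := measurable_lintegral_add m hΦ
  have hG1t : ∀ τ, Measurable fun w =>
      ∫⁻ v, workloadOp l m F τ (w + v) ∂(expMeasure m) := fun τ => hG1.comp measurable_prodMk_left
  rcases x with _ | x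
  · have h := workloadOp_renewal hl hm hF ht (Or.inr ⟨rfl, rfl⟩)
    simp only [zero_mul, add_zero, lintegral_const, measure_univ, mul_one] at h
    refine le_trans (le_of_eq ?_) (h.trans (le_of_eq ?_))
    · simp_rw [queueOp_apply, erlangOp_succ l m hF, erlangOp, erlang, zero_tsub,
        lintegral_dirac' _ hF]
      congr 1
      refine lintegral_congr fun s => ?_
      rw [lintegral_dirac' _ (hG1t _), erlang, lintegral_dirac' _ (hΦt _)]
    · rw [erlangOp, erlang, lintegral_dirac' _ (hΦt _)]
  · have hG2 := measurable_lintegral_add m hG1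
    have hp : Measurable fun p : ℝ × ℝ => ((t - p.2, p.1) : ℝ × ℝ) := by fun_prop
    have hsum := ((hG2.comp hp).const_mul (ENNReal.ofReal (l / (l + m)))).add
      ((hΦ.comp hp).const_mul (ENNReal.ofReal (m / (l + m))))
    have hF' : Measurable fun w => ∫⁻ v, F (w + v) ∂(expMeasure m) :=
      (hF.comp (measurable_fst.add measurable_snd)).lintegral_prod_right'
    rw [erlangOp_succ l m hF, lintegral_erlang_succ m x hF, ← lintegral_const_mul _ hF']
    have hq : ∀ s, queueOp l m (erlangOp l m F (t - s)) (x + 1) =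
        ∫⁻ w, (ENNReal.ofReal (l / (l + m)) *
          ∫⁻ v, ∫⁻ b, workloadOp l m F (t - s) (w + v + b) ∂(expMeasure m) ∂(expMeasure m) +
        ENNReal.ofReal (m / (l + m)) * workloadOp l m F (t - s) w) ∂(erlang m x) := by
      intro s
      have hG2t : Measurable fun w => ∫⁻ v, ∫⁻ b, workloadOp l m F (t - s) (w + v + b)
          ∂(expMeasure m) ∂(expMeasure m) := hG2.comp measurable_prodMk_left
      rw [queueOp_apply, erlangOp_succ l m hF, lintegral_erlang_succ m x (hG1t _),
        lintegral_add_left (hG2t.const_mul _), lintegral_const_mul _ hG2t,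
        lintegral_const_mul _ (hΦt _)]
      rfl
    simp_rw [hq]
    rw [← lintegral_lintegral_swap hsum.aemeasurable, ← lintegral_add_left (hF'.const_mul _)]
    refine lintegral_mono_ae ((ae_erlang_nonneg x).mono fun w hw => ?_)
    have h := workloadOp_renewal hl hm hF ht (Or.inl ⟨rfl, hw⟩)
    simp only [one_mul] at h
    exact h

/-- Convolution of the exponential law with Poisson weights: the next epoch count. -/
lemma setLIntegral_expMeasure_poisson {c t : ℝ} (hc : 0 < c) (ht : 0 ≤ t) (k : ℕ) :
    ∫⁻ s in Iic t, ENNReal.ofReal (exp (-(c * (t - s))) * (c * (t - s)) ^ k / k !)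
      ∂(expMeasure c) =
      ENNReal.ofReal (exp (-(c * t)) * (c * t) ^ (k + 1) / (k + 1)!) := by
  set A : ℝ := exp (-(c * t)) * c ^ (k + 1) / k ! with hA
  have hmeas : Measurable fun s : ℝ =>
      ENNReal.ofReal (exp (-(c * (t - s))) * (c * (t - s)) ^ k / k !) := by fun_prop
  rw [← lintegral_indicator measurableSet_Iic,
    lintegral_expMeasure c (hmeas.indicator measurableSet_Iic)]
  have e : ∫⁻ s in Ioi 0, ENNReal.ofReal (c * exp (-(c * s))) * (Iic t).indicator
        (fun s => ENNReal.ofReal (exp (-(c * (t - s))) * (c * (t - s)) ^ k / k !)) s =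
      ∫⁻ s in Ioc 0 t, ENNReal.ofReal (A * (t - s) ^ k) := by
    rw [← Ioi_inter_Iic, inter_comm, ← setLIntegral_indicator measurableSet_Iic]
    refine lintegral_congr fun s => ?_
    by_cases hs : s ∈ Iic t
    · rw [indicator_of_mem hs, indicator_of_mem hs, ← ENNReal.ofReal_mul (by positivity)]
      congr 1
      have : exp (-(c * t)) = exp (-(c * s)) * exp (-(c * (t - s))) := by
        rw [← exp_add]
        congr 1
        ring
      rw [hA, this, mul_pow]
      ring
    · rw [indicator_of_notMem hs, indicator_of_notMem hs, mul_zero]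
  have hint : IntervalIntegrable (fun s : ℝ => A * (t - s) ^ k) volume 0 t :=
    Continuous.intervalIntegrable (by fun_prop) _ _
  have hval : ∫ s in (0 : ℝ)..t, A * (t - s) ^ k = A * (t ^ (k + 1) / (k + 1)) := by
    rw [intervalIntegral.integral_const_mul, intervalIntegral.integral_comp_sub_left
      (fun s => s ^ k) t]
    simp
  rw [e, ← ofReal_integral_eq_lintegral_ofReal
    ((intervalIntegrable_iff_integrableOn_Ioc_of_le ht).1 hint),
    ← intervalIntegral.integral_of_le ht, hval]
  · congr 1
    rw [hA, Nat.factorial_succ, mul_pow]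
    push_cast
    field_simp
  · filter_upwards [ae_restrict_mem measurableSet_Ioc] with s hs
    have : 0 ≤ t - s := sub_nonneg.2 hs.2
    positivity

lemma queueOp_sum (l m : ℝ) (n : ℕ) (c : ℕ → ℝ≥0∞) (g : ℕ → ℕ → ℝ≥0∞) (x : ℕ) :
    queueOp l m (fun y => ∑ k ∈ Finset.range n, c k * g k y) x =
      ∑ k ∈ Finset.range n, c k * queueOp l m (g k) x := by
  simp only [queueOp_apply, Finset.mul_sum, ← Finset.sum_add_distrib]
  refine Finset.sum_congr rfl fun k _ => ?_
  ring

lemma queueOp_mono (l m : ℝ) {f g : ℕ → ℝ≥0∞} (h : ∀ x, f x ≤ g x) (x : ℕ) :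
    queueOp l m f x ≤ queueOp l m g x :=
  lintegral_mono h

/-- Iteration of the decomposition at the first epoch: the workload dominates every partial sum of
the Poisson mixture of Erlang laws along the queue length. -/
lemma sum_le_erlangOp {l m : ℝ} (hl : 0 < l) (hm : 0 < m) {F : ℝ → ℝ≥0∞} (hF : Measurable F)
    (n : ℕ) {t : ℝ} (ht : 0 ≤ t) (x : ℕ) :
    ∑ k ∈ Finset.range n, ENNReal.ofReal (exp (-((l + m) * t)) * ((l + m) * t) ^ k / k !) *
        (queueOp l m)^[k] (fun y => ∫⁻ w, F w ∂(erlang m y)) x ≤ erlangOp l m F t x := by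
  induction n generalizing t x with
  | zero => simp
  | succ n ih =>
    refine le_trans ?_ (erlangOp_renewal hl hm hF ht x)
    rw [Finset.sum_range_succ', add_comm]
    refine add_le_add (by simp) ?_
    calc _ = ∫⁻ s in Iic t, ∑ k ∈ Finset.range n,
            ENNReal.ofReal (exp (-((l + m) * (t - s))) * ((l + m) * (t - s)) ^ k / k !) *
              (queueOp l m)^[k + 1] (fun y => ∫⁻ w, F w ∂(erlang m y)) x
            ∂(expMeasure (l + m)) := by
          rw [lintegral_finsetSum _ fun k _ => by fun_prop]
          refine Finset.sum_congr rfl fun k _ => ?_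
          rw [lintegral_mul_const _ (by fun_prop),
            setLIntegral_expMeasure_poisson (by positivity) ht]
      _ ≤ _ := by
          refine setLIntegral_mono' measurableSet_Iic fun s hs => ?_
          simp_rw [Function.iterate_succ_apply']
          rw [← queueOp_sum]
          exact queueOp_mono l m (fun y => ih (sub_nonneg.2 hs) y) x

/-- The workload and the queue length are intertwined by the Erlang laws. Both sides are
probability measures, so it suffices that the left-hand side dominates. -/
lemma workloadLaw_bind_erlang {l m : ℝ} (hl : 0 < l) (hm : 0 < m) (ν : Measure ℕ)
    [IsProbabilityMeasure ν] {t : ℝ} (ht : 0 ≤ t) :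
    workloadLaw l m (ν.bind (erlang m)) t = (queueLaw l m ν t).bind (erlang m) := by
  have hE := isProbabilityMeasure_erlang hm
  have hQ := isProbabilityMeasure_queueLaw hl hm ν t
  have hbind : ∀ P : Measure ℕ, IsProbabilityMeasure P →
      IsProbabilityMeasure (P.bind (erlang m)) := fun P hP => ⟨by
    rw [Measure.bind_apply MeasurableSet.univ (by fun_prop)]
    simp⟩
  have h1 := hbind ν ‹_›
  have h2 := hbind _ hQ
  have h3 : IsProbabilityMeasure (workloadLaw l m (ν.bind (erlang m)) t) :=
    Measure.isProbabilityMeasure_map (measurable_workload l m t).aemeasurable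
  refine (Measure.eq_of_le_of_isProbabilityMeasure (Measure.le_iff.2 fun s hs => ?_)).symm
  have hF : Measurable (s.indicator (1 : ℝ → ℝ≥0∞)) := measurable_one.indicator hs
  have hΦ : Measurable fun w => workloadOp l m (s.indicator 1) t w :=
    (measurable_workloadOp l m hF).comp measurable_prodMk_left
  have hpart : ∀ x, ∫⁻ n, (queueOp l m)^[n] (fun y => ∫⁻ w, s.indicator 1 w ∂(erlang m y)) x
      ∂(poissonMeasure ((l + m) * t).toNNReal) ≤ erlangOp l m (s.indicator 1) t x := fun x => by
    rw [lintegral_poissonMeasure, ENNReal.tsum_eq_iSup_nat]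
    refine iSup_le fun n => ?_
    rw [Real.coe_toNNReal _ (by positivity)]
    exact sum_le_erlangOp hl hm hF n ht x
  calc _ = ∫⁻ y, ∫⁻ w, s.indicator 1 w ∂(erlang m y) ∂(queueLaw l m ν t) := by
        rw [Measure.bind_apply hs (by fun_prop)]
        simp_rw [lintegral_indicator_one hs]
    _ = ∫⁻ x, ∫⁻ n, (queueOp l m)^[n] (fun y => ∫⁻ w, s.indicator 1 w ∂(erlang m y)) x
          ∂(poissonMeasure ((l + m) * t).toNNReal) ∂ν := by
        rw [lintegral_queueLaw, lintegral_lintegral_swap]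
        exact Measurable.of_discrete.aemeasurable
    _ ≤ ∫⁻ x, erlangOp l m (s.indicator 1) t x ∂ν := lintegral_mono hpart
    _ = ∫⁻ w, workloadOp l m (s.indicator 1) t w ∂(ν.bind (erlang m)) := by
        rw [Measure.lintegral_bind (by fun_prop) hΦ.aemeasurable]
        rfl
    _ ≤ ∫⁻ w, ∫⁻ ω, s.indicator 1 (workload l m w t ω) ∂driveLaw ∂(ν.bind (erlang m)) :=
        lintegral_mono fun w => lintegral_mono fun ω => tsum_workloadOn_le hl _ t w ω
    _ = workloadLaw l m (ν.bind (erlang m)) t s := by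
        rw [workloadLaw, ← lintegral_indicator_one hs, lintegral_map hF (measurable_workload l m t),
          lintegral_prod (fun p : ℝ × Drive => s.indicator (1 : ℝ → ℝ≥0∞) (workload l m p.1 t p.2))
            (hF.comp (measurable_workload l m t)).aemeasurable]

end MM1

end

theorem mainTheorem2 :
    -- the laws called equilibria are invariant
    (∀ l m : ℝ, 0 < l → l < m → ∀ t, 0 ≤ t →
      MM1.queueLaw l m (MM1.queueEq l m) t = MM1.queueEq l m ∧
      MM1.workloadLaw l m (MM1.workloadEq l m) t = MM1.workloadEq l m) ∧
    -- change of the arrival rate from `l0` to `l`, queue length and workload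
    (∀ l0 l m : ℝ, 0 < l0 → 0 < l → l0 < m → l < m →
      MM1.ArrivalChangeBounds l0 l m
        (fun t => MM1.tvDist (MM1.queueLaw l m (MM1.queueEq l0 m) t) (MM1.queueEq l m)) ∧
      MM1.ArrivalChangeBounds l0 l m
        (fun t => MM1.tvDist (MM1.workloadLaw l m (MM1.workloadEq l0 m) t)
          (MM1.workloadEq l m))) ∧
    -- change of both rates from `(l0, m0)` to `(l, m)`; `s = b * t` is the rescaled time
    (∀ l0 m0 l m a b : ℝ, 0 < l0 → 0 < l → l0 < m0 → l < m →
      a * b * l0 = l → b * m0 = m →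
      (∀ t, 0 ≤ t →
        MM1.tvDist (MM1.queueLaw l m (MM1.queueEq l0 m0) t) (MM1.queueEq l m) =
          MM1.tvDist (MM1.queueLaw (a * l0) m0 (MM1.queueEq l0 m0) (b * t))
            (MM1.queueEq (a * l0) m0)) ∧
      MM1.ArrivalChangeBounds l0 (a * l0) m0
        (fun s => MM1.tvDist (MM1.queueLaw l m (MM1.queueEq l0 m0) (s / b))
          (MM1.queueEq l m))) := by
  have hqueue : ∀ l0 l m : ℝ, 0 < l0 → 0 < l → l0 < m → l < m →
      MM1.ArrivalChangeBounds l0 l m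
        (fun t => MM1.tvDist (MM1.queueLaw l m (MM1.queueEq l0 m) t) (MM1.queueEq l m)) := by
    intro l0 l m h0 hl h0m hlm
    have := MM1.isProbabilityMeasure_queueEq h0 h0m
    have := MM1.isProbabilityMeasure_queueEq hl hlm
    refine MM1.arrivalChangeBounds_of_closeOnTests h0 hl h0m hlm fun t ht B hB hclose => ?_
    have := MM1.isProbabilityMeasure_queueLaw hl (hl.trans hlm) (MM1.queueEq l0 m) t
    simpa only [Measure.bind_dirac] using hclose.tvDist_bind_le hB Measure.dirac
  refine ⟨fun l m hl hlm t ht => ⟨MM1.queueLaw_queueEq hl hlm t, ?_⟩,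
    fun l0 l m h0 hl h0m hlm => ⟨hqueue l0 l m h0 hl h0m hlm, ?_⟩, ?_⟩
  · have := MM1.isProbabilityMeasure_queueEq hl hlm
    rw [← MM1.bind_erlang_queueEq hl hlm, MM1.workloadLaw_bind_erlang hl (hl.trans hlm) _ ht,
      MM1.queueLaw_queueEq hl hlm]
  · have := MM1.isProbabilityMeasure_queueEq h0 h0m
    have := MM1.isProbabilityMeasure_queueEq hl hlm
    have := MM1.isProbabilityMeasure_erlang (hl.trans hlm)
    refine MM1.arrivalChangeBounds_of_closeOnTests h0 hl h0m hlm fun t ht B hB hclose => ?_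
    have := MM1.isProbabilityMeasure_queueLaw hl (hl.trans hlm) (MM1.queueEq l0 m) t
    rw [← MM1.bind_erlang_queueEq hl hlm, ← MM1.bind_erlang_queueEq h0 h0m,
      MM1.workloadLaw_bind_erlang hl (hl.trans hlm) _ ht]
    exact hclose.tvDist_bind_le hB _
  · intro l0 m0 l m a b h0 hl h0m hlm hal hbm
    have hm0 : 0 < m0 := h0.trans h0m
    have hb : 0 < b := pos_of_mul_pos_left (hbm ▸ hl.trans hlm) hm0.le
    have hal0 : b * (a * l0) = l := by rw [← hal]; ring
    have hl' : 0 < a * l0 := pos_of_mul_pos_right (hal0 ▸ hl) hb.le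
    have hlm' : a * l0 < m0 := by
      rw [← hal0, ← hbm] at hlm
      exact lt_of_mul_lt_mul_left hlm hb.le
    -- the embedded chain and the equilibrium depend only on the ratio of the rates
    have hsum : l + m = b * (a * l0 + m0) := by rw [← hal0, ← hbm]; ring
    have hEq : MM1.queueEq l m = MM1.queueEq (a * l0) m0 := by
      rw [MM1.queueEq, MM1.queueEq, ← hal0, ← hbm, mul_div_mul_left _ _ hb.ne']
    have hStep : MM1.queueStep l m = MM1.queueStep (a * l0) m0 := by
      funext x
      rw [MM1.queueStep, MM1.queueStep, hsum, ← hal0, ← hbm, mul_div_mul_left _ _ hb.ne',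
        mul_div_mul_left _ _ hb.ne']
    have hStepLaw : ∀ ν n, MM1.queueStepLaw l m ν n = MM1.queueStepLaw (a * l0) m0 ν n := by
      intro ν n
      induction n with
      | zero => rfl
      | succ n ih => rw [MM1.queueStepLaw, MM1.queueStepLaw, ih, hStep]
    have hLaw : ∀ ν t, MM1.queueLaw l m ν t = MM1.queueLaw (a * l0) m0 ν (b * t) := by
      intro ν t
      have e : (l + m) * t = (a * l0 + m0) * (b * t) := by rw [hsum]; ring
      rw [MM1.queueLaw, MM1.queueLaw, e, funext (hStepLaw ν)]
    refine ⟨fun t _ => by rw [hLaw, hEq], ?_⟩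
    have e : (fun s => MM1.tvDist (MM1.queueLaw l m (MM1.queueEq l0 m0) (s / b))
        (MM1.queueEq l m)) = fun s => MM1.tvDist (MM1.queueLaw (a * l0) m0 (MM1.queueEq l0 m0) s)
          (MM1.queueEq (a * l0) m0) := by
      funext s
      rw [hLaw, hEq, mul_div_cancel₀ _ hb.ne']
    rw [e]
    exact hqueue l0 (a * l0) m0 h0 hl' h0m hlm'
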